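/- **Setting.** Let $S$ and $A$ be Borel spaces (Borel subsets of complete separable metric spaces), let $K\subseteq S\times A$ be closed with sections $A(s)=\{a:(s,a)\in K\}$, let $Q(\cdot\mid s,a)$, $(s,a)\in K$, be a stochastic kernel on $S$, and let $r:K\to\mathbb R$ be a measurable reward. Let $z:K\to\mathbb R^n$, let $\Xi\subset\mathbb R^p$ be compact, and let $u(\cdot;\xi):\mathbb R^n\to\mathbb R$, $\xi\in\Xi$, be increasing (for the componentwise order) and concave, with $\xi\mapsto u(x;\xi)$ continuous on $\Xi$ for every $x\in\mathbb R^n$. Let $Y$ be a random vector in $\mathbb R^n$ whose support lies in a compact box $[a,b]$, and put $y(\xi)=\mathbb E[u(Y;\xi)]$. A policy $\pi$ is a sequence of stochastic kernels $\pi_t(da\mid h_t)$ on $A$ given $h_t\in H_t=K^t\times S$, $t\ge 0$, concentrated on $A(s_t)$, where $s_t$ is the last entry of $h_t$. With an initial distribution $\nu$ on $S$ it determines the law of the process $(s_t,a_t)_{t\ge0}$, with expectation $\mathbb E_\nu^\pi$. Let $$R(\pi,\nu)=\liminf_{T\to\infty}\tfrac1T\,\mathbb E_\nu^\pi\Big[\sum_{t=0}^{T-1}r(s_t,a_t)\Big],\qquad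 Z_\xi(\pi,\nu)=\liminf_{T\to\infty}\tfrac1T\,\mathbb E_\nu^\pi\Big[\sum_{t=0}^{T-1}u(z(s_t,a_t);\xi)\Big].$$ Put $w(s,a)=1-r(s,a)$ on $K$ and $\hat w(s)=1-\sup_{a\in A(s)}r(s,a)$ on $S$. Let $\mathcal F_{\hat w}(S)$ be the space of measurable $h:S\to\mathbb R$ with $\sup_s|h(s)|/\hat w(s)<\infty$, define $\mathcal F_w(K)$ in the same way, and let $\mathcal M_w(K)$ be the space of signed measures $\mu$ on $K$ with $\int w\,d|\mu|<\infty$. Let $\mathcal M(\Xi)$ be the space of finite signed Borel measures on $\Xi$. **Assumptions.** 1. There are a policy $\pi$ and an initial distribution $\nu$ with $R(\pi,\nu)>-\infty$ and $Z_\xi(\pi,\nu)\ge y(\xi)$ for all $\xi\in\Xi$. 2. $r\le 0$, and $\{(s,a)\in K: r(s,a)\ge-\epsilon\}$ is compact for every $\epsilon\ge0$. 3. $z$ is bounded and componentwise upper semicontinuous on $K$. 4. $Q$ is weakly continuous: $(s,a)\mapsto\int_S h\,dQ(\cdot\mid s,a)$ is continuous on $K$ for every bounded continuous $h:S\to\mathbb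 R$. 5. The function $(s,a)\mapsto\int_S\hat w\,dQ(\cdot\mid s,a)$ is finite and belongs to $\mathcal F_w(K)$. **The two programs.** The primal linear program is $$\max\ \langle\mu,r\rangle=\int_K r\,d\mu$$ over $\mu\in\mathcal M_w(K)$, $\mu\ge0$, subject to $\mu(K)=1$, $$\mu\big((B\times A)\cap K\big)-\int_K Q(B\mid s,a)\,\mu(d(s,a))=0\quad\text{for all Borel }B\subseteq S,$$ $$\int_K u(z(s,a);\xi)\,\mu(d(s,a))\ge y(\xi)\quad\text{for all }\xi\in\Xi.$$ The dual linear program is $$\inf\ \beta-\int_\Xi\mathbb E[u(Y;\xi)]\,\Lambda(d\xi)$$ over $(h,\beta,\Lambda)\in\mathcal F_{\hat w}(S)\times\mathbb R\times\mathcal M(\Xi)$ with $\Lambda\ge0$, subject to $$r(s,a)+\int_\Xi u(z(s,a);\xi)\,\Lambda(d\xi)\le\beta+h(s)-\int_S h(x)\,Q(dx\mid s,a)\quad\text{for all }(s,a)\in K.$$ **Theorem.** Under assumptions 1–5, the optimal values of the primal and the dual program are equal, and the primal value is attained. Suppose moreover that the dual program has a minimizing sequence $(h^i,\beta^i,\Lambda^i)$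 of feasible points such that $(\beta^i)$ is bounded in $\mathbb R$, $(h^i)$ is bounded in $\mathcal F_{\hat w}(S)$ (that is, $\sup_{i,s}|h^i(s)|/\hat w(s)<\infty$), and $(\Lambda^i)$ is bounded in the weak* topology (that is, $\sup_i|\int f\,d\Lambda^i|<\infty$ for every continuous $f:\Xi\to\mathbb R$). Then the dual program is solvable (its optimal value is attained) and strong duality holds: the two optimal values are equal and both are attained. -/

import Mathlib

namespace DominanceMDP

open MeasureTheory ProbabilityTheory Filter Topology

/-- An average reward Markov decision process: the closed set `K` of feasible state-action pairs
(so `A(s) = {a | (s, a) ∈ K}`), the transition law `Q(· | s, a)` and the reward `r`. -/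
structure MDP (S A : Type*) [TopologicalSpace S] [TopologicalSpace A]
    [MeasurableSpace S] [MeasurableSpace A] where
  K : Set (S × A)
  isClosed_K : IsClosed K
  Q : Kernel K S
  markov_Q : IsMarkovKernel Q
  r : K → ℝ
  measurable_r : Measurable r

/-- The data of a dominance-constrained problem: the vector of performance measures `z`,
the parameter set `Ξ ⊆ ℝᵖ`, the generating family `u(·; ξ)` and the benchmark random vector `Y`. -/
structure Model (S A Ω : Type*) [TopologicalSpace S] [TopologicalSpace A]
    [MeasurableSpace S] [MeasurableSpace A] [MeasurableSpace Ω] (n p : ℕ)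
    extends MDP S A where
  z : K → (Fin n → ℝ)
  Ξ : Set (Fin p → ℝ)
  u : (Fin n → ℝ) → Ξ → ℝ
  P : Measure Ω
  Y : Ω → (Fin n → ℝ)

section Dynamics

variable {S A : Type*} [TopologicalSpace S] [TopologicalSpace A]
  [MeasurableSpace S] [MeasurableSpace A]

/-- A history-dependent randomized policy that respects the constraints `K`: the stochastic
kernels `π_t(da | h_t)` on `H_t = Kᵗ × S`. -/
structure Policy (M : MDP S A) where
  act : (t : ℕ) → Kernel ((Fin t → M.K) × S) A
  markov_act : ∀ t, IsMarkovKernel (act t)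
  feasible : ∀ t (h : (Fin t → M.K) × S), act t h {a | (h.2, a) ∈ M.K} = 1

variable [BorelSpace S] [BorelSpace A] [SecondCountableTopology S] [SecondCountableTopology A]

lemma MDP.measurableSet_K (M : MDP S A) : MeasurableSet M.K := M.isClosed_K.measurableSet

/-- The law of the pair `(s_t, a_t)`, as a point of `K`, given the history `h_t = (…, s_t)`. -/
noncomputable def Policy.pair {M : MDP S A} (π : Policy M) (t : ℕ) :
    Kernel ((Fin t → M.K) × S) M.K :=
  ((Kernel.deterministic Prod.snd measurable_snd) ×ₖ (π.act t)).comapRight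
    (MeasurableEmbedding.subtype_coe M.measurableSet_K)

instance {M : MDP S A} (π : Policy M) (t : ℕ) : IsMarkovKernel (π.pair t) := by
  have := π.markov_act
  refine Kernel.IsMarkovKernel.comapRight _ _ fun h => ?_
  rw [Subtype.range_coe, Kernel.prod_apply, Kernel.deterministic_apply, Measure.dirac_prod,
    Measure.map_apply measurable_prodMk_left M.measurableSet_K]
  exact π.feasible t h

/-- The history `(k_0, …, k_t) ∈ K^{t+1}` indexed by `Fin (t + 1)`. -/
def toFin {X : Type*} {t : ℕ} (k : Finset.Iic t → X) : Fin (t + 1) → X :=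
  fun i => k ⟨i, Finset.mem_Iic.2 (Nat.lt_succ_iff.1 i.2)⟩

lemma measurable_toFin {X : Type*} [MeasurableSpace X] {t : ℕ} :
    Measurable (toFin : (Finset.Iic t → X) → (Fin (t + 1) → X)) :=
  measurable_pi_lambda _ fun _ => measurable_pi_apply _

/-- The law of the history `h_{t+1} = (k_0, …, k_t, s_{t+1})` given the pairs `k_0, …, k_t`. -/
noncomputable def MDP.nextState (M : MDP S A) (t : ℕ) :
    Kernel (Finset.Iic t → M.K) ((Fin (t + 1) → M.K) × S) :=
  (Kernel.deterministic toFin measurable_toFin) ×ₖ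
    (M.Q.comap (fun k => k ⟨t, Finset.mem_Iic.2 le_rfl⟩) (measurable_pi_apply _))

instance (M : MDP S A) (t : ℕ) : IsMarkovKernel (M.nextState t) := by
  have := M.markov_Q
  unfold MDP.nextState
  infer_instance

/-- The law of `(s_{t+1}, a_{t+1})` given the pairs up to time `t`. -/
noncomputable def Policy.step {M : MDP S A} (π : Policy M) (t : ℕ) :
    Kernel (Finset.Iic t → M.K) M.K :=
  (π.pair (t + 1)) ∘ₖ (M.nextState t)

instance {M : MDP S A} (π : Policy M) (t : ℕ) : IsMarkovKernel (π.step t) := by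
  unfold Policy.step
  infer_instance

/-- The law of `(s_0, a_0)` when `s_0 ∼ ν`. -/
noncomputable def Policy.initLaw {M : MDP S A} (π : Policy M) (ν : Measure S) : Measure M.K :=
  (ν.map (fun s => ((Fin.elim0 : Fin 0 → M.K), s))).bind (π.pair 0)

instance {M : MDP S A} (π : Policy M) (ν : Measure S) [IsProbabilityMeasure ν] :
    IsProbabilityMeasure (π.initLaw ν) := by
  have : IsProbabilityMeasure (ν.map (fun s => ((Fin.elim0 : Fin 0 → M.K), s))) :=
    Measure.isProbabilityMeasure_map measurable_prodMk_left.aemeasurable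
  unfold Policy.initLaw
  infer_instance

/-- The law `P_ν^π` of the process `(s_t, a_t)_{t ≥ 0}` on the trajectory space. -/
noncomputable def Policy.law {M : MDP S A} (π : Policy M) (ν : Measure S)
    [IsProbabilityMeasure ν] : Measure (ℕ → M.K) :=
  Kernel.trajMeasure (X := fun _ => M.K) (π.initLaw ν) π.step

/-- The extended-real expectation `E f⁺ - E f⁻`. -/
noncomputable def extExp {X : Type*} [MeasurableSpace X] (P : Measure X) (f : X → ℝ) : EReal :=
  ((∫⁻ x, ENNReal.ofReal (f x) ∂P : ENNReal) : EReal)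
    - ((∫⁻ x, ENNReal.ofReal (-f x) ∂P : ENNReal) : EReal)

/-- Long-run expected average `liminf_T (1/T) E_ν^π [∑_{t<T} f(s_t, a_t)]`. -/
noncomputable def Policy.avg {M : MDP S A} (π : Policy M) (ν : Measure S)
    [IsProbabilityMeasure ν] (f : M.K → ℝ) : EReal :=
  liminf (fun T : ℕ => (((1 : ℝ) / T : ℝ) : EReal) *
    extExp (π.law ν) (fun ω => ∑ t ∈ Finset.range T, f (ω t))) atTop

end Dynamics

section LP

variable {S A : Type*} [TopologicalSpace S] [TopologicalSpace A]
  [MeasurableSpace S] [MeasurableSpace A]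

/-- The transition law is weakly continuous. -/
def MDP.WeaklyContinuous [OpensMeasurableSpace S] (M : MDP S A) : Prop :=
  ∀ h : BoundedContinuousFunction S ℝ, Continuous fun k : M.K => ∫ x, h x ∂(M.Q k)

/-- The weight `w(s, a) = 1 - r(s, a)` on `K`. -/
def MDP.w (M : MDP S A) (k : M.K) : ℝ := 1 - M.r k

/-- The weight `ŵ(s) = 1 - sup_{a ∈ A(s)} r(s, a)` on `S`. -/
noncomputable def MDP.wHat (M : MDP S A) (s : S) : ℝ :=
  1 - ⨆ a : {a : A // (s, a) ∈ M.K}, M.r ⟨(s, a.1), a.2⟩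

/-- Membership in the weighted space `F_w(X)`. -/
def MemF {X : Type*} [MeasurableSpace X] (w h : X → ℝ) : Prop :=
  Measurable h ∧ ∃ C : ℝ, ∀ x, |h x| / w x ≤ C

/-- `(s, a) ↦ ∫ ŵ dQ(· | s, a)` is (finite and) an element of `F_w(K)`. -/
def MDP.WeightBounded (M : MDP S A) : Prop :=
  (∀ k, Integrable M.wHat (M.Q k)) ∧ MemF M.w (fun k => ∫ x, M.wHat x ∂(M.Q k))

/-- A nonnegative measure on `K` belonging to `M_w(K)`: `∫ w dμ < ∞`. -/
def MDP.MemM (M : MDP S A) (μ : Measure M.K) : Prop :=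
  ∫⁻ k, ENNReal.ofReal (M.w k) ∂μ < ⊤

/-- `[L₀ μ](B) = μ̂(B) - ∫ Q(B | s, a) dμ`, where `μ̂` is the marginal of `μ` on `S`. -/
noncomputable def MDP.L0 (M : MDP S A) (μ : Measure M.K) (B : Set S) : ℝ :=
  (μ.map fun k => k.1.1).real B - ∫ k, (M.Q k).real B ∂μ

variable {Ω : Type*} [MeasurableSpace Ω] {n p : ℕ}

/-- `y(ξ) = E[u(Y; ξ)]`. -/
noncomputable def Model.y (M : Model S A Ω n p) (ξ : M.Ξ) : ℝ := ∫ ω, M.u (M.Y ω) ξ ∂M.P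

/-- `[L₁ μ](ξ) = ⟨μ, u(z; ξ)⟩`. -/
noncomputable def Model.L1 (M : Model S A Ω n p) (μ : Measure M.K) (ξ : M.Ξ) : ℝ :=
  ∫ k, M.u (M.z k) ξ ∂μ

/-- `[L₁* Λ](s, a) = ∫ u(z(s, a); ξ) Λ(dξ)`. -/
noncomputable def Model.L1adj (M : Model S A Ω n p) (Λ : Measure M.Ξ) (k : M.K) : ℝ :=
  ∫ ξ, M.u (M.z k) ξ ∂Λ

/-- Feasibility in the primal linear program. -/
structure Model.PrimalFeasible (M : Model S A Ω n p) (μ : Measure M.K) : Prop where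
  mem : M.MemM μ
  invariant : ∀ B : Set S, MeasurableSet B → M.L0 μ B = 0
  mass : ∫ _k, (1 : ℝ) ∂μ = 1
  dominance : ∀ ξ, M.y ξ ≤ M.L1 μ ξ

/-- The primal objective `⟨μ, r⟩`. -/
noncomputable def Model.primalObj (M : Model S A Ω n p) (μ : Measure M.K) : ℝ := ∫ k, M.r k ∂μ

/-- The optimal value of the primal linear program. -/
noncomputable def Model.primalValue (M : Model S A Ω n p) : EReal :=
  sSup {v : EReal | ∃ μ, M.PrimalFeasible μ ∧ v = (M.primalObj μ : EReal)}

/-- The primal linear program attains its optimal value. -/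
def Model.PrimalSolvable (M : Model S A Ω n p) : Prop :=
  ∃ μ, M.PrimalFeasible μ ∧ (M.primalObj μ : EReal) = M.primalValue

/-- Feasibility in the dual linear program, `(h, β, Λ) ∈ F_ŵ(S) × ℝ × M(Ξ)` with `Λ ≥ 0`. -/
structure Model.DualFeasible (M : Model S A Ω n p) (h : S → ℝ) (β : ℝ) (Λ : Measure M.Ξ) :
    Prop where
  mem : MemF M.wHat h
  finite : IsFiniteMeasure Λ
  constraint : ∀ k : M.K, M.r k + M.L1adj Λ k ≤ β + h k.1.1 - ∫ x, h x ∂(M.Q k)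

/-- The dual objective `β - ∫ E[u(Y; ξ)] Λ(dξ)`. -/
noncomputable def Model.dualObj (M : Model S A Ω n p) (β : ℝ) (Λ : Measure M.Ξ) : ℝ :=
  β - ∫ ξ, M.y ξ ∂Λ

/-- The optimal value of the dual linear program. -/
noncomputable def Model.dualValue (M : Model S A Ω n p) : EReal :=
  sInf {v : EReal | ∃ h β Λ, M.DualFeasible h β Λ ∧ v = (M.dualObj β Λ : EReal)}

/-- The dual linear program attains its optimal value. -/
def Model.DualSolvable (M : Model S A Ω n p) : Prop :=
  ∃ h β Λ, M.DualFeasible h β Λ ∧ (M.dualObj β Λ : EReal) = M.dualValue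

/-- Strong duality: equal optimal values, both attained. -/
def Model.StrongDuality (M : Model S A Ω n p) : Prop :=
  M.primalValue = M.dualValue ∧ M.PrimalSolvable ∧ M.DualSolvable

/-- There is a minimizing sequence `(hⁿ, βⁿ, Λⁿ)` of the dual linear program with `βⁿ` bounded,
`hⁿ` bounded in `F_ŵ(S)` and `Λⁿ` bounded in the weak* topology induced by `C(Ξ)`. -/
def Model.BoundedMinimizingSequence (M : Model S A Ω n p) : Prop :=
  ∃ (h : ℕ → S → ℝ) (β : ℕ → ℝ) (Λ : ℕ → Measure M.Ξ),
    (∀ i, M.DualFeasible (h i) (β i) (Λ i)) ∧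
    Tendsto (fun i => (M.dualObj (β i) (Λ i) : EReal)) atTop (𝓝 M.dualValue) ∧
    (∃ C : ℝ, ∀ i, |β i| ≤ C) ∧
    (∃ C : ℝ, ∀ i s, |h i s| / M.wHat s ≤ C) ∧
    (∀ f : C(M.Ξ, ℝ), ∃ C : ℝ, ∀ i, |∫ ξ, f ξ ∂(Λ i)| ≤ C)

variable [BorelSpace S] [BorelSpace A] [SecondCountableTopology S] [SecondCountableTopology A]

/-- Consistency of the dominance-constrained decision problem: for some policy and initial
distribution, `R(π, ν) > -∞` and `Z_ξ(π, ν) ≥ E[u(Y; ξ)]` for all `ξ ∈ Ξ`. -/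
def Model.Consistent (M : Model S A Ω n p) : Prop :=
  ∃ (π : Policy M.toMDP) (ν : ProbabilityMeasure S),
    ⊥ < π.avg (ν : Measure S) M.r ∧
    ∀ ξ : M.Ξ, (M.y ξ : EReal) ≤ π.avg (ν : Measure S) (fun k => M.u (M.z k) ξ)

end LP

end DominanceMDP

set_option linter.unusedSectionVars false

namespace DominanceMDP

open MeasureTheory ProbabilityTheory Filter Topology
open scoped ENNReal

/-! ### Weak compactness of probability measures and a finite-dimensional route to minimax. -/

section Compactness

variable {X : Type*} [TopologicalSpace X] [TopologicalSpace.MetrizableSpace X]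
  [SecondCountableTopology X] [MeasurableSpace X] [BorelSpace X]

/-! The only source of compactness on the primal side is the reward. Since `-r` is nonnegative with
compact sublevel sets, a bound on `∫ -r dμ` makes a set of probability measures tight, hence weakly
compact by Prokhorov (`isCompact_setOf_lintegral_le`). The primal constraints survive weak limits:
invariance is tested on bounded continuous functions, which weak continuity of `Q` preserves, and
`u(z; ξ)` is bounded and upper semicontinuous. Occupation measures of a consistent policy satisfy
the constraints up to errors that vanish, because the balance equation telescopes; a limit point is
feasible. The same limit argument applied to a maximizing sequence gives primal attainment.

One inequality between the values is obtained by integrating the dual constraint against a feasible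
measure (`weak_duality`). For the other, take `V` above the primal value and consider the Lagrangian
integrands obtained from `r` by adding multiplier terms for invariance and dominance. A measure
whose integrals against all of them were at least `V` would be feasible, by scaling the multipliers,
and would have objective at least `V`. So every measure is beaten by some integrand, and a minimax
argument yields one integrand that is at most `V` pointwise: compactness reduces to finitely many
integrands, finite-dimensional separation supplies convex weights, and Dirac measures give the
pointwise bound (`exists_forall_le_of_forall_exists_integral_lt`, `exists_dualFeasible_le`). Such an
integrand is a dual feasible point.

For dual attainment, `β` and `Λ` converge along subsequences by compactness. No compactness is
available for `h`, but the pointwise lower limit suffices, since the inequality has the direction of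
Fatou's lemma (`exists_memF_of_tendsto`). -/

/-- By the layer-cake formula this reduces to the open sets `{f > t}`, where the portmanteau
inequality applies; Fatou in `t` finishes. -/
lemma lintegral_le_liminf_of_lowerSemicontinuous {f : X → ℝ} (hf : LowerSemicontinuous f)
    (hn : 0 ≤ f) {μ : ProbabilityMeasure X} {μs : ℕ → ProbabilityMeasure X}
    (h : Tendsto μs atTop (𝓝 μ)) :
    ∫⁻ x, ENNReal.ofReal (f x) ∂(μ : Measure X) ≤
      liminf (fun i => ∫⁻ x, ENNReal.ofReal (f x) ∂(μs i : Measure X)) atTop := by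
  simp_rw [lintegral_eq_lintegral_meas_lt _ (Eventually.of_forall hn) hf.measurable.aemeasurable]
  refine (lintegral_mono fun t => ProbabilityMeasure.le_liminf_measure_open_of_tendsto h
    (hf.isOpen_preimage t)).trans ?_
  exact lintegral_liminf_le fun n => Antitone.measurable fun s t hst =>
    measure_mono fun ω hω => lt_of_le_of_lt hst hω

lemma isClosed_setOf_lintegral_le {f : X → ℝ} (hf : LowerSemicontinuous f) (hn : 0 ≤ f)
    (c : ℝ≥0∞) :
    IsClosed {μ : ProbabilityMeasure X | ∫⁻ x, ENNReal.ofReal (f x) ∂(μ : Measure X) ≤ c} := by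
  refine IsSeqClosed.isClosed fun μs μ hμs h => ?_
  refine (lintegral_le_liminf_of_lowerSemicontinuous hf hn h).trans ?_
  exact (liminf_le_limsup).trans (limsup_le_of_le (by isBoundedDefault)
    (Eventually.of_forall hμs))

lemma lowerSemicontinuous_of_isCompact_sublevel {f : X → ℝ} (hn : 0 ≤ f)
    (hK : ∀ t : ℝ, 0 ≤ t → IsCompact {x | f x ≤ t}) : LowerSemicontinuous f := by
  rw [lowerSemicontinuous_iff_isClosed_preimage]
  intro t
  rcases le_or_gt 0 t with ht | ht
  · exact (hK t ht).isClosed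
  · convert isClosed_empty
    ext x
    simpa using ht.trans_le (hn x)

/-- Markov's inequality gives mass at most `ε` outside the compact set `{f ≤ c / ε}`, so the family
is tight and Prokhorov applies; lower semicontinuity of `f` makes it closed. -/
lemma isCompact_setOf_lintegral_le {f : X → ℝ} (hn : 0 ≤ f)
    (hK : ∀ t : ℝ, 0 ≤ t → IsCompact {x | f x ≤ t}) {c : ℝ≥0∞} (hc : c ≠ ⊤) :
    IsCompact {μ : ProbabilityMeasure X | ∫⁻ x, ENNReal.ofReal (f x) ∂(μ : Measure X) ≤ c} := by
  have hf := lowerSemicontinuous_of_isCompact_sublevel hn hK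
  rw [← (isClosed_setOf_lintegral_le hf hn c).closure_eq]
  refine isCompact_closure_of_isTightMeasureSet ?_
  rw [isTightMeasureSet_iff_exists_isCompact_measure_compl_le]
  intro ε hε
  rcases eq_or_ne ε ⊤ with rfl | hε'
  · exact ⟨∅, isCompact_empty, fun _ _ => le_top⟩
  have hcε : c / ε ≠ ⊤ := ENNReal.div_ne_top hc hε.ne'
  refine ⟨_, hK (c / ε).toReal ENNReal.toReal_nonneg, ?_⟩
  rintro _ ⟨μ, hμ, rfl⟩
  -- For `c = 0` the level `c / ε` vanishes and Markov's inequality says nothing; instead `f = 0`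
  -- almost everywhere.
  rcases eq_or_ne c 0 with rfl | hc0
  · have h0 : ∀ᵐ x ∂(μ : Measure X), ENNReal.ofReal (f x) = 0 :=
      (lintegral_eq_zero_iff hf.measurable.ennreal_ofReal).1 (le_antisymm hμ bot_le)
    refine (le_of_eq ?_).trans (zero_le (a := ε))
    rw [measure_eq_zero_iff_ae_notMem]
    filter_upwards [h0] with x hx
    simpa using ENNReal.ofReal_eq_zero.1 hx
  have key := mul_meas_ge_le_lintegral₀ (μ := (μ : Measure X))
    hf.measurable.ennreal_ofReal.aemeasurable (c / ε)
  have hsub : {x | f x ≤ (c / ε).toReal}ᶜ ⊆ {x | c / ε ≤ ENNReal.ofReal (f x)} := by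
    intro x hx
    simp only [Set.mem_compl_iff, Set.mem_ofPred_eq, not_le] at hx ⊢
    exact ENNReal.le_ofReal_iff_toReal_le hcε (hn x) |>.2 hx.le
  have h1 : c / ε * (μ : Measure X) {x | f x ≤ (c / ε).toReal}ᶜ ≤ c :=
    (mul_le_mul_right (measure_mono hsub) _).trans (key.trans hμ)
  have h2 : c / ε ≠ 0 := ENNReal.div_ne_zero.2 ⟨hc0, hε'⟩
  calc (μ : Measure X) {x | f x ≤ (c / ε).toReal}ᶜ ≤ c / (c / ε) := by
        rw [ENNReal.le_div_iff_mul_le (Or.inl h2) (Or.inl hcε), mul_comm]; exact h1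
    _ = ε := ENNReal.div_div_cancel hc0 hc

/-- A convex set of vectors each having a coordinate below `V` lies in a half-space
`∑ lᵢ xᵢ ≤ V` for suitable convex weights `l`. -/
lemma exists_weights_sum_le {ι : Type*} [Fintype ι] {C : Set (ι → ℝ)} (hC : Convex ℝ C)
    (hne : C.Nonempty) {V : ℝ} (h : ∀ x ∈ C, ∃ i, x i < V) :
    ∃ l : ι → ℝ, (∀ i, 0 ≤ l i) ∧ ∑ i, l i = 1 ∧ ∀ x ∈ C, ∑ i, l i * x i ≤ V := by
  classical
  have hO : IsOpen {x : ι → ℝ | ∀ i, V < x i} := by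
    simp only [Set.ofPred_forall]
    exact isOpen_iInter_of_finite fun i => isOpen_lt continuous_const (continuous_apply i)
  have hOc : Convex ℝ {x : ι → ℝ | ∀ i, V < x i} := by
    simp only [Set.ofPred_forall]
    exact convex_iInter fun i =>
      convex_halfSpace_gt (f := fun x : ι → ℝ => x i)
        (LinearMap.proj (R := ℝ) (φ := fun _ => ℝ) i).isLinear V
  have hdisj : Disjoint {x : ι → ℝ | ∀ i, V < x i} C := by
    rw [Set.disjoint_left]
    intro x hx hxC
    obtain ⟨i, hi⟩ := h x hxC
    exact absurd (hx i) (not_lt.2 hi.le)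
  -- The open orthant above `V` is separated from `C`; the coefficients `m` of `-φ`, once
  -- normalized, are the weights.
  obtain ⟨φ, c, hφ1, hφ2⟩ := geometric_hahn_banach_open hOc hO hC hdisj
  set m : ι → ℝ := fun i => - φ (Pi.single i 1) with hm
  have hφ : ∀ x, φ x = - ∑ i, m i * x i := by
    intro x
    conv_lhs => rw [pi_eq_sum_univ' x, map_sum]
    rw [← Finset.sum_neg_distrib]
    refine Finset.sum_congr rfl fun i _ => ?_
    rw [map_smul, hm]; simp [mul_comm]
  have hlow : ∀ x : ι → ℝ, (∀ i, V < x i) → -c < ∑ i, m i * x i := by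
    intro x hx
    have := hφ1 x hx
    rw [hφ] at this; linarith
  have hup : ∀ x ∈ C, ∑ i, m i * x i ≤ -c := by
    intro x hx
    have := hφ2 x hx
    rw [hφ] at this; linarith
  have hmn : ∀ i, 0 ≤ m i := by
    intro i
    -- With a negative coefficient, moving far enough along the `i`-th axis stays inside the orthant
    -- but violates the separation.
    by_contra hi
    push Not at hi
    set s := ∑ j, m j * (V + 1) with hs
    have hval : ∀ t : ℝ, ∑ j, m j * ((fun j => V + 1) + t • Pi.single i (1 : ℝ) : ι → ℝ) j
        = s + t * m i := by
      intro t
      simp only [Pi.add_apply, Pi.smul_apply, smul_eq_mul, mul_add, Finset.sum_add_distrib, hs]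
      simp only [Pi.single_apply, mul_ite, mul_one, mul_zero, Finset.sum_ite_eq',
        Finset.mem_univ, if_true]
      ring
    have ht : 0 ≤ (|s + c| + 1) / (- m i) := by
      have : 0 < - m i := by linarith
      positivity
    have := hlow ((fun j => V + 1) + ((|s + c| + 1) / (- m i)) • Pi.single i (1 : ℝ)) (by
      intro j
      simp only [Pi.add_apply, Pi.smul_apply, smul_eq_mul, Pi.single_apply]
      split_ifs <;> nlinarith)
    rw [hval] at this
    have h3 : (|s + c| + 1) / (- m i) * m i = - (|s + c| + 1) := by
      have : m i ≠ 0 := hi.ne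
      field_simp
    rw [h3] at this
    linarith [le_abs_self (s + c)]
  have hVc : (∑ i, m i) * V ≥ -c := by
    refine ge_of_tendsto (f := fun e : ℝ => ∑ i, m i * (V + e)) (x := 𝓝[>] 0)
      ?_ ?_
    · have : Continuous fun e : ℝ => ∑ i, m i * (V + e) := by fun_prop
      have := (this.tendsto 0).mono_left (nhdsWithin_le_nhds (s := Set.Ioi 0))
      simpa [Finset.sum_mul] using this
    · filter_upwards [self_mem_nhdsWithin] with e he
      exact (hlow (fun _ => V + e) fun i => by simpa using he).le
  have hms : 0 < ∑ i, m i := by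
    -- If all coefficients vanished, a point of `C` would give `0 ≤ -c` and a point of the orthant
    -- `-c < 0`.
    refine lt_of_le_of_ne (Finset.sum_nonneg fun i _ => hmn i) fun h0 => ?_
    have hz : ∀ i, m i = 0 := fun i =>
      (Finset.sum_eq_zero_iff_of_nonneg fun i _ => hmn i).1 h0.symm i (Finset.mem_univ i)
    obtain ⟨x, hx⟩ := hne
    have h1 := hup x hx
    have h2 := hlow (fun _ => V + 1) fun _ => by simp
    simp only [hz, zero_mul, Finset.sum_const_zero] at h1 h2
    linarith
  refine ⟨fun i => m i / ∑ j, m j, fun i => div_nonneg (hmn i) hms.le, ?_, fun x hx => ?_⟩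
  · rw [← Finset.sum_div, div_self hms.ne']
  · simp only [div_mul_eq_mul_div]
    rw [← Finset.sum_div, div_le_iff₀ hms]
    linarith [hup x hx]

lemma lt_integral_iff_lt_lintegral {f : X → ℝ} (hn : 0 ≤ f) {μ : Measure X}
    (hi : Integrable f μ) {c : ℝ} (hc : 0 ≤ c) :
    ENNReal.ofReal c < ∫⁻ x, ENNReal.ofReal (f x) ∂μ ↔ c < ∫ x, f x ∂μ := by
  rw [← ofReal_integral_eq_lintegral_ofReal hi (Eventually.of_forall hn)]
  exact ENNReal.ofReal_lt_ofReal_iff_of_nonneg hc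

/-- Minimax principle for a convex family of upper semicontinuous functions that are bounded
above, one of which has compact superlevel sets. -/
theorem exists_forall_le_of_forall_exists_integral_lt [Nonempty X] {r : X → ℝ} (hr : ∀ x, r x ≤ 0)
    (hrK : ∀ t : ℝ, 0 ≤ t → IsCompact {x | -t ≤ r x}) {G : Set (X → ℝ)} (hG : Convex ℝ G)
    (hrG : r ∈ G) (husc : ∀ g ∈ G, UpperSemicontinuous g) (hbdd : ∀ g ∈ G, ∃ c, ∀ x, g x ≤ c)
    (hint : ∀ g ∈ G, ∀ μ : Measure X, IsProbabilityMeasure μ → Integrable r μ → Integrable g μ)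
    {V : ℝ} (h : ∀ μ : Measure X, IsProbabilityMeasure μ → Integrable r μ →
      ∃ g ∈ G, ∫ x, g x ∂μ < V) :
    ∃ g ∈ G, ∀ x, g x ≤ V := by
  classical
  have hrn : (0 : X → ℝ) ≤ fun x => - r x := fun x => by simpa using hr x
  have hrK' : ∀ t : ℝ, 0 ≤ t → IsCompact {x | - r x ≤ t} := by
    intro t ht
    convert hrK t ht using 1
    ext x; simp only [Set.mem_ofPred_eq]; constructor <;> intro <;> linarith
  have hrl := lowerSemicontinuous_of_isCompact_sublevel hrn hrK'
  have hc := isCompact_setOf_lintegral_le hrn hrK' (ENNReal.ofReal_ne_top (r := - V))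
  choose! b hb using hbdd
  -- Shifting by `c g` makes `c g - g` nonnegative and lower semicontinuous; the maximum with `V`
  -- keeps the threshold `c g - V` nonnegative, so `ENNReal.ofReal` does not truncate it.
  set c : (X → ℝ) → ℝ := fun g => max (b g) V with hcdef
  have hcn : ∀ g ∈ G, (0 : X → ℝ) ≤ fun x => c g - g x := fun g hg x => by
    exact sub_nonneg.2 ((hb g hg x).trans (le_max_left _ V))
  have hcl : ∀ g ∈ G, LowerSemicontinuous fun x => c g - g x := fun g hg => by
    have h1 := husc g hg
    intro x y hxy
    have := h1 x (c g - y) (by linarith)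
    filter_upwards [this] with z hz
    linarith
  set U : G → Set (ProbabilityMeasure X) := fun g =>
    {μ | ∫⁻ x, ENNReal.ofReal (c g - g.1 x) ∂(μ : Measure X) ≤ ENNReal.ofReal (c g - V)}ᶜ with hU
  have hUo : ∀ g, IsOpen (U g) := fun g =>
    (isClosed_setOf_lintegral_le (hcl g g.2) (hcn g g.2) _).isOpen_compl
  have hUmem : ∀ (g : G) (μ : ProbabilityMeasure X), Integrable r (μ : Measure X) →
      (μ ∈ U g ↔ ∫ x, g.1 x ∂(μ : Measure X) < V) := by
    intro g μ hμ
    have hgi := hint g g.2 μ inferInstance hμ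
    have hV : 0 ≤ c g - V := by simp [hcdef]
    rw [hU, Set.mem_compl_iff, Set.mem_ofPred_eq, not_le,
      lt_integral_iff_lt_lintegral (hcn g g.2) ((integrable_const _).sub hgi) hV,
      integral_sub (integrable_const _) hgi]
    simp
  have hri : ∀ μ : ProbabilityMeasure X, ∫⁻ x, ENNReal.ofReal (- r x) ∂(μ : Measure X) ≠ ⊤ →
      Integrable r (μ : Measure X) := by
    intro μ hμ
    have : Integrable (fun x => - r x) (μ : Measure X) :=
      (lintegral_ofReal_ne_top_iff_integrable hrl.measurable.aestronglyMeasurable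
        (Eventually.of_forall hrn)).1 hμ
    simpa using this.neg
  obtain ⟨s, hs⟩ := hc.elim_finite_subcover U hUo (by
    intro μ hμ
    have hμi := hri μ (ne_top_of_le_ne_top ENNReal.ofReal_ne_top hμ)
    obtain ⟨g, hg, hlt⟩ := h μ inferInstance hμi
    exact Set.mem_iUnion.2 ⟨⟨g, hg⟩, (hUmem ⟨g, hg⟩ μ hμi).2 hlt⟩)
  -- The finite subcover handles measures with `∫ -r ≤ -V`; for all others `r` itself has integral
  -- below `V`.
  let t : Finset G := insert ⟨r, hrG⟩ s
  have ht : ∀ μ : Measure X, IsProbabilityMeasure μ → Integrable r μ →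
      ∃ g : t, ∫ x, g.1.1 x ∂μ < V := by
    intro μ hμp hμ
    by_cases hμc : ∫⁻ x, ENNReal.ofReal (- r x) ∂μ ≤ ENNReal.ofReal (-V)
    · obtain ⟨g, hg⟩ := Set.mem_iUnion.1 (hs (show (⟨μ, hμp⟩ : ProbabilityMeasure X) ∈ _ from hμc))
      obtain ⟨hgs, hgU⟩ := Set.mem_iUnion.1 hg
      exact ⟨⟨g, Finset.mem_insert_of_mem hgs⟩, (hUmem g ⟨μ, hμp⟩ hμ).1 hgU⟩
    · refine ⟨⟨⟨r, hrG⟩, Finset.mem_insert_self _ _⟩, ?_⟩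
      rw [not_le, ← ofReal_integral_eq_lintegral_ofReal (f := fun x => - r x) hμ.neg (Eventually.of_forall hrn)] at hμc
      have h1 := (ENNReal.ofReal_lt_ofReal_iff' .. |>.1 hμc).1
      rw [integral_neg] at h1
      simpa using h1
  let C : Set (t → ℝ) :=
    {v | ∃ μ : Measure X, IsProbabilityMeasure μ ∧ Integrable r μ ∧ v = fun g => ∫ x, g.1.1 x ∂μ}
  have hCconv : Convex ℝ C := by
    rintro _ ⟨μ, hμp, hμ, rfl⟩ _ ⟨ν, hνp, hν, rfl⟩ p q hp hq hpq
    refine ⟨ENNReal.ofReal p • μ + ENNReal.ofReal q • ν, ⟨?_⟩, ?_, ?_⟩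
    · simp only [Measure.coe_add, Measure.coe_smul, Pi.add_apply, Pi.smul_apply, measure_univ,
        smul_eq_mul, mul_one]
      rw [← ENNReal.ofReal_add hp hq, hpq, ENNReal.ofReal_one]
    · exact (hμ.smul_measure ENNReal.ofReal_ne_top).add_measure
        (hν.smul_measure ENNReal.ofReal_ne_top)
    · ext g
      have h1 := hint g.1.1 g.1.2 μ hμp hμ
      have h2 := hint g.1.1 g.1.2 ν hνp hν
      rw [integral_add_measure (h1.smul_measure ENNReal.ofReal_ne_top)
        (h2.smul_measure ENNReal.ofReal_ne_top), integral_smul_measure, integral_smul_measure]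
      simp [ENNReal.toReal_ofReal hp, ENNReal.toReal_ofReal hq]
  have hdirac : ∀ x : X, Integrable r (Measure.dirac x) := fun x =>
    integrable_dirac (by simp)
  obtain ⟨l, hl0, hl1, hl⟩ := exists_weights_sum_le hCconv
    ⟨_, Measure.dirac (Classical.arbitrary X), inferInstance, hdirac _, rfl⟩ (V := V) (by
      rintro _ ⟨μ, hμp, hμ, rfl⟩
      exact ht μ hμp hμ)
  refine ⟨∑ g : t, l g • g.1.1, hG.sum_mem (fun g _ => hl0 g) hl1 fun g _ => g.1.2, fun x => ?_⟩
  have := hl _ ⟨Measure.dirac x, inferInstance, hdirac x, rfl⟩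
  simpa [integral_dirac] using this

end Compactness

end DominanceMDP

/-! ### Bounds, semicontinuity and integrability under the standing assumptions. -/

namespace DominanceMDP

open MeasureTheory ProbabilityTheory Filter Topology
open scoped ENNReal BoundedContinuousFunction

/-- Near `k` every coordinate of `z` stays below `z k + e`; monotonicity transfers this to `φ`, and
continuity of `φ` makes the loss small. -/
lemma upperSemicontinuous_comp_of_monotone {X : Type*} [TopologicalSpace X] {n : ℕ}
    {φ : (Fin n → ℝ) → ℝ} (hφ : Continuous φ) (hm : Monotone φ) {z : X → Fin n → ℝ}
    (hz : ∀ i, UpperSemicontinuous fun k => z k i) : UpperSemicontinuous fun k => φ (z k) := by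
  intro k c hc
  have h1 : Tendsto (fun e : ℝ => φ (fun i => z k i + e)) (𝓝[>] 0) (𝓝 (φ (z k))) := by
    have : Continuous fun e : ℝ => φ (fun i => z k i + e) := by fun_prop
    simpa using (this.tendsto 0).mono_left (nhdsWithin_le_nhds (s := Set.Ioi 0))
  obtain ⟨e, he, he0⟩ := ((h1.eventually_lt_const hc).and self_mem_nhdsWithin).exists
  have h2 : ∀ᶠ k' in 𝓝 k, ∀ i, z k' i < z k i + e :=
    eventually_all.2 fun i => hz i k _ (by simpa using he0)
  filter_upwards [h2] with k' hk'
  exact (hm fun i => (hk' i).le).trans_lt he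

variable {S A Ω : Type*}
    [TopologicalSpace S] [TopologicalSpace.MetrizableSpace S] [SecondCountableTopology S]
    [MeasurableSpace S] [BorelSpace S]
    [TopologicalSpace A] [TopologicalSpace.MetrizableSpace A] [SecondCountableTopology A]
    [MeasurableSpace A] [BorelSpace A]
    [MeasurableSpace Ω] {n p : ℕ}

/-- The standing assumptions on a dominance-constrained model, apart from consistency. -/
structure Model.Standing (M : Model S A Ω n p) : Prop where
  r_nonpos : ∀ k, M.r k ≤ 0
  r_compact : ∀ ε : ℝ, 0 ≤ ε → IsCompact {k : M.K | -ε ≤ M.r k}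
  z_bounded : ∃ C : ℝ, ∀ k, ‖M.z k‖ ≤ C
  z_usc : ∀ i, UpperSemicontinuous fun k => M.z k i
  weaklyContinuous : M.WeaklyContinuous
  weightBounded : M.WeightBounded
  compact_Ξ : IsCompact M.Ξ
  monotone_u : ∀ ξ : M.Ξ, Monotone fun x => M.u x ξ
  concave_u : ∀ ξ : M.Ξ, ConcaveOn ℝ Set.univ fun x => M.u x ξ
  continuous_param : ∀ x, Continuous fun ξ : M.Ξ => M.u x ξ
  prob_P : IsProbabilityMeasure M.P
  measurable_Y : Measurable M.Y
  bounded_Y : ∃ a b : Fin n → ℝ, ∀ᵐ ω ∂M.P, M.Y ω ∈ Set.Icc a b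

/-- The state component of a feasible state-action pair. -/
def MDP.state (M : MDP S A) (k : M.K) : S := k.1.1

lemma MDP.continuous_state (M : MDP S A) : Continuous M.state :=
  continuous_fst.comp continuous_subtype_val

lemma MDP.measurable_state (M : MDP S A) : Measurable M.state := M.continuous_state.measurable

namespace Model.Standing

variable {M : Model S A Ω n p} (H : M.Standing)
include H

lemma compactSpace : CompactSpace M.Ξ := isCompact_iff_compactSpace.1 H.compact_Ξ

lemma one_le_w (k : M.K) : 1 ≤ M.w k := by
  have := H.r_nonpos k
  unfold MDP.w; linarith

lemma one_le_wHat (s : S) : 1 ≤ M.wHat s := by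
  -- For a state without feasible actions the real supremum defaults to `0`, so the bound holds
  -- there too.
  have : ⨆ a : {a : A // (s, a) ∈ M.K}, M.r ⟨(s, a.1), a.2⟩ ≤ 0 :=
    Real.iSup_nonpos fun a => H.r_nonpos _
  unfold MDP.wHat; linarith

lemma wHat_le_w (k : M.K) : M.wHat (M.state k) ≤ M.w k := by
  have hb : BddAbove (Set.range fun a : {a : A // (M.state k, a) ∈ M.K} =>
      M.r ⟨(M.state k, a.1), a.2⟩) := ⟨0, by rintro _ ⟨a, rfl⟩; exact H.r_nonpos _⟩
  have := le_ciSup hb ⟨k.1.2, k.2⟩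
  unfold MDP.wHat MDP.w
  have h2 : M.r ⟨(M.state k, k.1.2), k.2⟩ = M.r k := rfl
  linarith

lemma integrable_w {μ : Measure M.K} [IsFiniteMeasure μ] (hμ : Integrable M.r μ) :
    Integrable M.w μ := (integrable_const (1 : ℝ)).sub hμ

lemma memM_iff {μ : Measure M.K} [IsFiniteMeasure μ] : M.MemM μ ↔ Integrable M.r μ := by
  have hm : Measurable M.w := measurable_const.sub M.measurable_r
  have h1 : M.MemM μ ↔ Integrable M.w μ := by
    rw [← lintegral_ofReal_ne_top_iff_integrable hm.aestronglyMeasurable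
      (Eventually.of_forall fun k => zero_le_one.trans (H.one_le_w k))]
    exact lt_top_iff_ne_top
  rw [h1]
  refine ⟨fun h => ?_, H.integrable_w⟩
  have := (integrable_const (1 : ℝ)).sub h
  refine this.congr (Eventually.of_forall fun k => ?_)
  simp [MDP.w]

lemma exists_abs_le_wHat {h : S → ℝ} (hh : MemF M.wHat h) :
    ∃ C : ℝ, 0 ≤ C ∧ ∀ s, |h s| ≤ C * M.wHat s := by
  obtain ⟨C, hC⟩ := hh.2
  refine ⟨max C 0, le_max_right _ _, fun s => ?_⟩
  have hw : 0 < M.wHat s := zero_lt_one.trans_le (H.one_le_wHat s)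
  have := (div_le_iff₀ hw).1 (hC s)
  exact this.trans (mul_le_mul_of_nonneg_right (le_max_left _ _) hw.le)

lemma memF_boundedContinuous (h : S →ᵇ ℝ) : MemF M.wHat h := by
  refine ⟨h.continuous.measurable, ‖h‖, fun s => ?_⟩
  rw [div_le_iff₀ (zero_lt_one.trans_le (H.one_le_wHat s))]
  have h1 := h.norm_coe_le_norm s
  rw [Real.norm_eq_abs] at h1
  exact h1.trans (le_mul_of_one_le_right (norm_nonneg _) (H.one_le_wHat s))

lemma integrable_state {h : S → ℝ} (hh : MemF M.wHat h) {μ : Measure M.K} [IsFiniteMeasure μ]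
    (hμ : Integrable M.r μ) : Integrable (fun k => h (M.state k)) μ := by
  obtain ⟨C, hC0, hC⟩ := H.exists_abs_le_wHat hh
  refine ((H.integrable_w hμ).const_mul C).mono'
    (hh.1.comp M.measurable_state).aestronglyMeasurable (Eventually.of_forall fun k => ?_)
  exact (hC _).trans (mul_le_mul_of_nonneg_left (H.wHat_le_w k) hC0)

lemma measurable_integral_Q {h : S → ℝ} (hh : Measurable h) :
    Measurable fun k => ∫ x, h x ∂(M.Q k) := by
  have := M.markov_Q
  exact (hh.stronglyMeasurable.integral_kernel (κ := M.Q)).measurable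

/-- The weight condition on `Q` bounds `∫ h dQ` by a multiple of `w`, which is integrable as soon as
`r` is. -/
lemma integrable_integral_Q {h : S → ℝ} (hh : MemF M.wHat h) {μ : Measure M.K}
    [IsFiniteMeasure μ] (hμ : Integrable M.r μ) : Integrable (fun k => ∫ x, h x ∂(M.Q k)) μ := by
  obtain ⟨C, hC0, hC⟩ := H.exists_abs_le_wHat hh
  obtain ⟨hwi, hwm, D, hD⟩ := H.weightBounded
  refine ((H.integrable_w hμ).const_mul (C * D)).mono'
    (H.measurable_integral_Q hh.1).aestronglyMeasurable (Eventually.of_forall fun k => ?_)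
  have h1 : |∫ x, M.wHat x ∂(M.Q k)| ≤ D * M.w k :=
    (div_le_iff₀ (zero_lt_one.trans_le (H.one_le_w k))).1 (hD k)
  calc ‖∫ x, h x ∂(M.Q k)‖ ≤ ∫ x, C * M.wHat x ∂(M.Q k) :=
        norm_integral_le_of_norm_le ((hwi k).const_mul C) (Eventually.of_forall hC)
    _ = C * ∫ x, M.wHat x ∂(M.Q k) := integral_const_mul _ _
    _ ≤ C * (D * M.w k) := mul_le_mul_of_nonneg_left ((le_abs_self _).trans h1) hC0
    _ = C * D * M.w k := by ring

/-- A finite concave function on all of `ℝⁿ` is locally Lipschitz. -/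
lemma continuous_u (ξ : M.Ξ) : Continuous fun x => M.u x ξ :=
  (H.concave_u ξ).locallyLipschitz.continuous

/-- Monotonicity squeezes the values over the box between those at its two corners, and these are
continuous in `ξ` on a compact set. -/
lemma exists_abs_u_le (a b : Fin n → ℝ) :
    ∃ C : ℝ, ∀ x ∈ Set.Icc a b, ∀ ξ, |M.u x ξ| ≤ C := by
  have := H.compactSpace
  obtain ⟨C1, h1⟩ := isCompact_univ.exists_bound_of_continuousOn
    (H.continuous_param a).continuousOn
  obtain ⟨C2, h2⟩ := isCompact_univ.exists_bound_of_continuousOn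
    (H.continuous_param b).continuousOn
  refine ⟨max C1 C2, fun x hx ξ => abs_le.2 ⟨?_, ?_⟩⟩
  · have h3 := (abs_le.1 (h1 ξ trivial)).1
    have h4 : M.u a ξ ≤ M.u x ξ := H.monotone_u ξ hx.1
    linarith [le_max_left C1 C2]
  · have h3 := (abs_le.1 (h2 ξ trivial)).2
    have h4 : M.u x ξ ≤ M.u b ξ := H.monotone_u ξ hx.2
    linarith [le_max_right C1 C2]

lemma exists_abs_u_z_le : ∃ C : ℝ, 0 ≤ C ∧ ∀ k ξ, |M.u (M.z k) ξ| ≤ C := by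
  obtain ⟨R, hR⟩ := H.z_bounded
  obtain ⟨C, hC⟩ := H.exists_abs_u_le (fun _ => -R) (fun _ => R)
  refine ⟨max C 0, le_max_right _ _, fun k ξ => (hC _ ⟨fun i => ?_, fun i => ?_⟩ ξ).trans
    (le_max_left _ _)⟩
  · exact (abs_le.1 ((norm_le_pi_norm (M.z k) i).trans (hR k))).1
  · exact (abs_le.1 ((norm_le_pi_norm (M.z k) i).trans (hR k))).2

lemma upperSemicontinuous_u_z (ξ : M.Ξ) : UpperSemicontinuous fun k => M.u (M.z k) ξ :=
  upperSemicontinuous_comp_of_monotone (H.continuous_u ξ) (H.monotone_u ξ) H.z_usc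

lemma integrable_u_z {μ : Measure M.K} [IsFiniteMeasure μ] (ξ : M.Ξ) :
    Integrable (fun k => M.u (M.z k) ξ) μ := by
  obtain ⟨C, -, hC⟩ := H.exists_abs_u_z_le
  exact (integrable_const C).mono' (H.upperSemicontinuous_u_z ξ).measurable.aestronglyMeasurable
    (Eventually.of_forall fun k => hC k ξ)

lemma integrable_of_continuous {Λ : Measure M.Ξ} [IsFiniteMeasure Λ] {f : M.Ξ → ℝ}
    (hf : Continuous f) : Integrable f Λ := by
  have := H.compactSpace
  exact (BoundedContinuousFunction.mkOfCompact ⟨f, hf⟩).integrable Λ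

/-- Mixing over `ξ` preserves monotonicity and concavity, so the mixed utility is again continuous
and can be composed with `z`. -/
lemma upperSemicontinuous_L1adj (Λ : Measure M.Ξ) [IsFiniteMeasure Λ] :
    UpperSemicontinuous (M.L1adj Λ) := by
  have hi : ∀ x, Integrable (fun ξ => M.u x ξ) Λ := fun x =>
    H.integrable_of_continuous (H.continuous_param x)
  refine upperSemicontinuous_comp_of_monotone (φ := fun x => ∫ ξ, M.u x ξ ∂Λ) ?_ ?_ H.z_usc
  · refine (ConcaveOn.locallyLipschitz ⟨convex_univ, fun x _ y _ a b ha hb hab => ?_⟩).continuous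
    simp only [smul_eq_mul]
    rw [← integral_const_mul, ← integral_const_mul,
      ← integral_add ((hi x).const_mul a) ((hi y).const_mul b)]
    exact integral_mono (((hi x).const_mul a).add ((hi y).const_mul b)) (hi _) fun ξ =>
      (H.concave_u ξ).2 trivial trivial ha hb hab
  · exact fun x y hxy => integral_mono (hi x) (hi y) fun ξ => H.monotone_u ξ hxy

lemma exists_abs_L1adj_le (Λ : Measure M.Ξ) [IsFiniteMeasure Λ] :
    ∃ C : ℝ, ∀ k, |M.L1adj Λ k| ≤ C := by
  obtain ⟨C, -, hC⟩ := H.exists_abs_u_z_le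
  refine ⟨C * Λ.real Set.univ, fun k => ?_⟩
  rw [← Real.norm_eq_abs]
  exact norm_integral_le_of_norm_le_const (Eventually.of_forall (hC k))

lemma integrable_L1adj (Λ : Measure M.Ξ) [IsFiniteMeasure Λ] {μ : Measure M.K}
    [IsFiniteMeasure μ] : Integrable (M.L1adj Λ) μ := by
  obtain ⟨C, hC⟩ := H.exists_abs_L1adj_le Λ
  exact (integrable_const C).mono' (H.upperSemicontinuous_L1adj Λ).measurable.aestronglyMeasurable
    (Eventually.of_forall hC)

/-- Fubini for a bounded integrand; joint measurability comes from continuity in `ξ` and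
measurability in `k` (a Carathéodory function). -/
lemma integral_L1adj (Λ : Measure M.Ξ) [IsFiniteMeasure Λ] (μ : Measure M.K)
    [IsFiniteMeasure μ] : Integrable (M.L1 μ) Λ ∧ ∫ k, M.L1adj Λ k ∂μ = ∫ ξ, M.L1 μ ξ ∂Λ := by
  obtain ⟨C, -, hC⟩ := H.exists_abs_u_z_le
  have hm : Measurable (Function.uncurry fun (ξ : M.Ξ) (k : M.K) => M.u (M.z k) ξ) :=
    measurable_uncurry_of_continuous_of_measurable (u := fun (ξ : M.Ξ) (k : M.K) => M.u (M.z k) ξ)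
      (fun k => H.continuous_param _) fun ξ => (H.upperSemicontinuous_u_z ξ).measurable
  have hi : Integrable (Function.uncurry fun (ξ : M.Ξ) (k : M.K) => M.u (M.z k) ξ) (Λ.prod μ) :=
    (integrable_const C).mono' hm.aestronglyMeasurable (Eventually.of_forall fun x => hC x.2 x.1)
  exact ⟨hi.integral_prod_left, (integral_integral_swap hi).symm⟩

lemma continuous_y : Continuous M.y := by
  have := H.prob_P
  obtain ⟨a, b, hab⟩ := H.bounded_Y
  obtain ⟨C, hC⟩ := H.exists_abs_u_le a b
  refine continuous_of_dominated (bound := fun _ => C)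
    (fun ξ => ((H.continuous_u ξ).measurable.comp H.measurable_Y).aestronglyMeasurable)
    (fun ξ => ?_) (integrable_const C) (Eventually.of_forall fun ω => H.continuous_param _)
  filter_upwards [hab] with ω hω
  exact hC _ hω ξ

/-! ### Invariance as an identity of measures, and weak duality. -/

omit H in
-- Stated for measures rather than set by set, invariance can be integrated against the unbounded
-- functions of `F_ŵ(S)`.
lemma map_state_eq_bind {μ : Measure M.K} [IsFiniteMeasure μ]
    (h : ∀ B : Set S, MeasurableSet B → M.L0 μ B = 0) : μ.map M.state = μ.bind M.Q := by
  have := M.markov_Q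
  ext B hB
  have h1 := h B hB
  rw [Measure.bind_apply hB M.Q.aemeasurable]
  have hQB : ∀ k, ENNReal.ofReal ((M.Q k).real B) = M.Q k B := fun k => ofReal_measureReal
  unfold MDP.L0 at h1
  rw [sub_eq_zero, integral_eq_lintegral_of_nonneg_ae
    (Eventually.of_forall fun k => measureReal_nonneg)
    (M.Q.measurable_coe hB).ennreal_toReal.aestronglyMeasurable] at h1
  simp only [hQB] at h1
  refine (ENNReal.toReal_eq_toReal_iff' (measure_ne_top (μ.map M.state) B) ?_).1 h1
  refine ne_top_of_le_ne_top (b := ∫⁻ _, 1 ∂μ) (by simp) (lintegral_mono fun k => prob_le_one)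

omit H in
lemma L0_eq_zero {μ : Measure M.K} (h : μ.map M.state = μ.bind M.Q) {B : Set S}
    (hB : MeasurableSet B) : M.L0 μ B = 0 := by
  have := M.markov_Q
  have hQB : ∀ k, ENNReal.ofReal ((M.Q k).real B) = M.Q k B := fun k => ofReal_measureReal
  unfold MDP.L0
  rw [sub_eq_zero, integral_eq_lintegral_of_nonneg_ae
    (Eventually.of_forall fun k => measureReal_nonneg)
    (M.Q.measurable_coe hB).ennreal_toReal.aestronglyMeasurable]
  simp only [hQB]
  rw [← Measure.bind_apply hB M.Q.aemeasurable, ← h]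
  rfl

omit H in
lemma integral_bind_Q {μ : Measure M.K} {h : S → ℝ} (hh : Integrable h (μ.bind M.Q)) :
    ∫ x, h x ∂(μ.bind M.Q) = ∫ k, ∫ x, h x ∂(M.Q k) ∂μ := by
  change Integrable h (M.Q ∘ₘ μ) at hh
  rw [Measure.comp_eq_comp_const_apply] at hh ⊢
  rw [Kernel.integral_comp hh, Kernel.const_apply]

/-- Invariance can be tested on bounded continuous functions. -/
lemma primalFeasible_of_tests {μ : Measure M.K} [IsProbabilityMeasure μ]
    (hμ : Integrable M.r μ)
    (hinv : ∀ h : S →ᵇ ℝ, ∫ k, (h (M.state k) - ∫ x, h x ∂(M.Q k)) ∂μ = 0)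
    (hdom : ∀ ξ, M.y ξ ≤ M.L1 μ ξ) : M.PrimalFeasible μ := by
  have := M.markov_Q
  have : IsProbabilityMeasure (μ.map M.state) :=
    Measure.isProbabilityMeasure_map M.measurable_state.aemeasurable
  refine ⟨H.memM_iff.2 hμ, fun B hB => L0_eq_zero ?_ hB, by simp, hdom⟩
  refine ext_of_forall_integral_eq_of_IsFiniteMeasure fun h => ?_
  rw [integral_map M.measurable_state.aemeasurable h.continuous.aestronglyMeasurable,
    integral_bind_Q (h.integrable _)]
  have h1 := hinv h
  rwa [integral_sub (H.integrable_state (H.memF_boundedContinuous h) hμ)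
    (H.integrable_integral_Q (H.memF_boundedContinuous h) hμ), sub_eq_zero] at h1

omit H in
-- Infinite mass is excluded because it would make the real-valued integral of `1` equal to `0`.
lemma isProbabilityMeasure_of_feasible {μ : Measure M.K} (hμ : M.PrimalFeasible μ) :
    IsProbabilityMeasure μ := by
  have := hμ.mass
  rw [integral_const, smul_eq_mul, mul_one] at this
  exact isProbabilityMeasure_iff_real.2 this

lemma integral_state_eq {μ : Measure M.K} (hμ : M.PrimalFeasible μ) {h : S → ℝ}
    (hh : MemF M.wHat h) :
    ∫ k, h (M.state k) ∂μ = ∫ k, ∫ x, h x ∂(M.Q k) ∂μ := by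
  have := isProbabilityMeasure_of_feasible hμ
  have hr := H.memM_iff.1 hμ.mem
  have hmap := map_state_eq_bind hμ.invariant
  rw [← integral_bind_Q, ← hmap,
    integral_map M.measurable_state.aemeasurable hh.1.aestronglyMeasurable]
  rw [← hmap, integrable_map_measure hh.1.aestronglyMeasurable M.measurable_state.aemeasurable]
  exact H.integrable_state hh hr

/-- Integrating the dual constraint against `μ` cancels the `h` terms by invariance; Fubini and
dominance compare the rest. -/
theorem weak_duality {μ : Measure M.K} (hμ : M.PrimalFeasible μ) {h : S → ℝ} {β : ℝ}
    {Λ : Measure M.Ξ} (hd : M.DualFeasible h β Λ) : M.primalObj μ ≤ M.dualObj β Λ := by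
  have := isProbabilityMeasure_of_feasible hμ
  have := hd.finite
  have hr := H.memM_iff.1 hμ.mem
  have hi1 := H.integrable_state hd.mem hr
  have hi2 := H.integrable_integral_Q hd.mem hr
  have hi3 : Integrable (M.L1adj Λ) μ := H.integrable_L1adj Λ
  have hi4 : Integrable (fun k => β + h (M.state k)) μ := (integrable_const β).add hi1
  have h1 : ∫ k, (M.r k + M.L1adj Λ k) ∂μ ≤
      ∫ k, (β + h (M.state k) - ∫ x, h x ∂(M.Q k)) ∂μ :=
    integral_mono (hr.add hi3) (hi4.sub hi2) hd.constraint
  rw [integral_add hr hi3, integral_sub hi4 hi2,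
    integral_add (integrable_const β) hi1, H.integral_state_eq hμ hd.mem,
    (H.integral_L1adj Λ μ).2] at h1
  have h2 : ∫ ξ, M.y ξ ∂Λ ≤ ∫ ξ, M.L1 μ ξ ∂Λ :=
    integral_mono (H.integrable_of_continuous H.continuous_y) (H.integral_L1adj Λ μ).1
      hμ.dominance
  simp only [integral_const, probReal_univ, one_smul] at h1
  unfold Model.primalObj Model.dualObj
  linarith

/-! ### Stability of primal feasibility under weak limits. -/

/-- Weak limits of asymptotically feasible measures are feasible. -/
theorem exists_primalFeasible_of_asymptotic {μs : ℕ → ProbabilityMeasure M.K} {c : ℝ} (hc : 0 ≤ c)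
    (hr : ∀ c' > c, ∀ᶠ T in atTop,
      ∫⁻ k, ENNReal.ofReal (- M.r k) ∂(μs T : Measure M.K) ≤ ENNReal.ofReal c')
    (hinv : ∀ h : S →ᵇ ℝ, Tendsto (fun T =>
      ∫ k, (h (M.state k) - ∫ x, h x ∂(M.Q k)) ∂(μs T : Measure M.K)) atTop (𝓝 0))
    (hdom : ∀ ξ, ∀ ε > 0, ∀ᶠ T in atTop, M.y ξ - ε ≤ M.L1 (μs T : Measure M.K) ξ) :
    ∃ μ, M.PrimalFeasible μ ∧ -c ≤ M.primalObj μ := by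
  have := M.markov_Q
  have hrn : (0 : M.K → ℝ) ≤ fun k => - M.r k := fun k => by simpa using H.r_nonpos k
  have hrK : ∀ t : ℝ, 0 ≤ t → IsCompact {k : M.K | - M.r k ≤ t} := by
    intro t ht
    convert H.r_compact t ht using 1
    ext k; simp only [Set.mem_ofPred_eq]; constructor <;> intro <;> linarith
  have hrl := lowerSemicontinuous_of_isCompact_sublevel hrn hrK
  obtain ⟨T0, hT0⟩ := eventually_atTop.1 (hr (c + 1) (by linarith))
  have hcomp := isCompact_setOf_lintegral_le hrn hrK (ENNReal.ofReal_ne_top (r := c + 1))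
  obtain ⟨μ, -, φ, hφ, hlim⟩ := hcomp.tendsto_subseq (x := fun T => μs (T + T0))
    fun T => hT0 _ (by omega)
  have hψ : Tendsto (fun T => φ T + T0) atTop atTop :=
    tendsto_atTop_mono (fun T => Nat.le_add_right _ _) hφ.tendsto_atTop
  have hle : ∀ c' > c, ∫⁻ k, ENNReal.ofReal (- M.r k) ∂(μ : Measure M.K) ≤ ENNReal.ofReal c' :=
    fun c' hc' => (isClosed_setOf_lintegral_le hrl hrn _).mem_of_tendsto hlim
      (hψ.eventually (hr c' hc'))
  have hi : Integrable (fun k => - M.r k) (μ : Measure M.K) :=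
    (lintegral_ofReal_ne_top_iff_integrable hrl.measurable.aestronglyMeasurable
      (Eventually.of_forall hrn)).1
      (ne_top_of_le_ne_top ENNReal.ofReal_ne_top (hle (c + 1) (by linarith)))
  have hri : Integrable M.r (μ : Measure M.K) := by simpa using hi.neg
  refine ⟨μ, H.primalFeasible_of_tests hri (fun h => ?_) fun ξ => ?_, ?_⟩
  · have hcont : Continuous fun k => h (M.state k) - ∫ x, h x ∂(M.Q k) :=
      (h.continuous.comp M.continuous_state).sub (H.weaklyContinuous h)
    let g : M.K →ᵇ ℝ := BoundedContinuousFunction.ofNormedAddCommGroup _ hcont (‖h‖ + ‖h‖) (by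
      intro k
      refine (norm_sub_le _ _).trans (add_le_add (h.norm_coe_le_norm _) ?_)
      simpa using norm_integral_le_of_norm_le_const (μ := M.Q k)
        (Eventually.of_forall h.norm_coe_le_norm))
    exact tendsto_nhds_unique
      (ProbabilityMeasure.tendsto_iff_forall_integral_tendsto.1 hlim g) ((hinv h).comp hψ)
  · obtain ⟨C, -, hC⟩ := H.exists_abs_u_z_le
    refine le_of_forall_pos_sub_le fun ε hε => ?_
    -- Reflecting at the bound `C` turns the upper semicontinuous utility into a nonnegative lower
    -- semicontinuous function, for which closedness is known.
    have hn : (0 : M.K → ℝ) ≤ fun k => C - M.u (M.z k) ξ := fun k =>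
      sub_nonneg.2 (abs_le.1 (hC k ξ)).2
    have hl : LowerSemicontinuous fun k => C - M.u (M.z k) ξ := by
      intro k t hkt
      filter_upwards [H.upperSemicontinuous_u_z ξ k (C - t) (by linarith)] with k' hk'
      linarith
    have key : ∀ ν : ProbabilityMeasure M.K,
        ∫⁻ k, ENNReal.ofReal (C - M.u (M.z k) ξ) ∂(ν : Measure M.K) =
          ENNReal.ofReal (C - M.L1 (ν : Measure M.K) ξ) := by
      intro ν
      rw [← ofReal_integral_eq_lintegral_ofReal (f := fun k => C - M.u (M.z k) ξ)
        ((integrable_const C).sub (H.integrable_u_z ξ)) (Eventually.of_forall hn),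
        integral_sub (integrable_const C) (H.integrable_u_z ξ)]
      simp [Model.L1]
    have hup : ∀ ν : ProbabilityMeasure M.K, M.L1 (ν : Measure M.K) ξ ≤ C := by
      intro ν
      have := integral_mono (μ := (ν : Measure M.K)) (H.integrable_u_z ξ) (integrable_const C)
        fun k => (abs_le.1 (hC k ξ)).2
      simpa [Model.L1] using this
    have hmem := (isClosed_setOf_lintegral_le hl hn
      (ENNReal.ofReal (C - (M.y ξ - ε)))).mem_of_tendsto hlim (by
        filter_upwards [hψ.eventually (hdom ξ ε hε)] with T hT
        rw [key]
        refine ENNReal.ofReal_le_ofReal ?_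
        simp only [Function.comp_apply]
        linarith)
    rw [Set.mem_ofPred_eq, key] at hmem
    -- One member of the sequence shows that the threshold is nonnegative, which is needed to remove
    -- `ENNReal.ofReal`.
    obtain ⟨T, hT⟩ := (hdom ξ ε hε).exists
    have h0 : 0 ≤ C - (M.y ξ - ε) := by linarith [hup (μs T)]
    have := (ENNReal.ofReal_le_ofReal_iff h0).1 hmem
    linarith
  · have h1 : ∫ k, - M.r k ∂(μ : Measure M.K) ≤ c := by
      refine le_of_forall_gt_imp_ge_of_dense fun c' hc' => ?_
      have h2 := hle c' hc'
      rw [← ofReal_integral_eq_lintegral_ofReal hi (Eventually.of_forall hrn)] at h2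
      exact (ENNReal.ofReal_le_ofReal_iff (hc.trans hc'.le)).1 h2
    rw [integral_neg] at h1
    unfold Model.primalObj
    linarith

/-! ### Lagrangian minimax: no duality gap. -/

/-- If no feasible measure has objective at least `V`, some dual feasible point has objective at
most `V`. -/
theorem exists_dualFeasible_le [Nonempty M.K] {V : ℝ}
    (hV : ∀ μ, M.PrimalFeasible μ → M.primalObj μ < V) :
    ∃ h β Λ, M.DualFeasible h β Λ ∧ M.dualObj β Λ ≤ V := by
  have := M.markov_Q
  -- Lagrangian integrand: on probability measures its integral is the objective plus the constraint
  -- residuals weighted by `h` and `Λ`. Bounded continuous `h` suffice, as they determine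
  -- invariance.
  set g : (S →ᵇ ℝ) → Measure M.Ξ → M.K → ℝ := fun h Λ k =>
    M.r k + (M.L1adj Λ k - ∫ ξ, M.y ξ ∂Λ) - (h (M.state k) - ∫ x, h x ∂(M.Q k)) with hg
  set G : Set (M.K → ℝ) := {f | ∃ h Λ, IsFiniteMeasure Λ ∧ f = g h Λ}
  have hQc : ∀ h : S →ᵇ ℝ, Continuous fun k => h (M.state k) - ∫ x, h x ∂(M.Q k) := fun h =>
    (h.continuous.comp M.continuous_state).sub (H.weaklyContinuous h)
  have hQb : ∀ (h : S →ᵇ ℝ) k, |h (M.state k) - ∫ x, h x ∂(M.Q k)| ≤ ‖h‖ + ‖h‖ := fun h k => by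
    refine (norm_sub_le _ _).trans (add_le_add (h.norm_coe_le_norm _) ?_)
    simpa using norm_integral_le_of_norm_le_const (μ := M.Q k)
      (Eventually.of_forall h.norm_coe_le_norm)
  have hQi : ∀ (h : S →ᵇ ℝ) (μ : Measure M.K) [IsProbabilityMeasure μ],
      Integrable (fun k => h (M.state k) - ∫ x, h x ∂(M.Q k)) μ := fun h μ _ =>
    (integrable_const (‖h‖ + ‖h‖)).mono' (hQc h).aestronglyMeasurable
      (Eventually.of_forall (hQb h))
  have hLi : ∀ (Λ : Measure M.Ξ) [IsFiniteMeasure Λ] (μ : Measure M.K) [IsProbabilityMeasure μ],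
      Integrable (fun k => M.L1adj Λ k - ∫ ξ, M.y ξ ∂Λ) μ := fun Λ _ μ _ =>
    (H.integrable_L1adj Λ).sub (integrable_const _)
  have hr_usc : UpperSemicontinuous M.r := by
    rw [upperSemicontinuous_iff_isClosed_preimage]
    intro t
    rcases le_or_gt t 0 with ht | ht
    · have := (H.r_compact (-t) (by linarith)).isClosed
      rwa [neg_neg] at this
    · convert isClosed_empty
      ext k
      simpa using (H.r_nonpos k).trans_lt ht
  have hcomb : Convex ℝ G := by
    rintro _ ⟨h1, Λ1, hf1, rfl⟩ _ ⟨h2, Λ2, hf2, rfl⟩ a b ha hb hab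
    have hsum : ∀ f : M.Ξ → ℝ, Continuous f →
        ∫ ξ, f ξ ∂(ENNReal.ofReal a • Λ1 + ENNReal.ofReal b • Λ2) =
          a * ∫ ξ, f ξ ∂Λ1 + b * ∫ ξ, f ξ ∂Λ2 := by
      intro f hf
      rw [integral_add_measure
        ((H.integrable_of_continuous hf).smul_measure ENNReal.ofReal_ne_top)
        ((H.integrable_of_continuous hf).smul_measure ENNReal.ofReal_ne_top),
        integral_smul_measure, integral_smul_measure]
      simp [ENNReal.toReal_ofReal ha, ENNReal.toReal_ofReal hb]
    have : IsFiniteMeasure (ENNReal.ofReal a • Λ1) := Λ1.smul_finite ENNReal.ofReal_ne_top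
    have : IsFiniteMeasure (ENNReal.ofReal b • Λ2) := Λ2.smul_finite ENNReal.ofReal_ne_top
    refine ⟨a • h1 + b • h2, ENNReal.ofReal a • Λ1 + ENNReal.ofReal b • Λ2, inferInstance, ?_⟩
    ext k
    have hQs : ∫ x, (a • h1 + b • h2) x ∂(M.Q k) =
        a * ∫ x, h1 x ∂(M.Q k) + b * ∫ x, h2 x ∂(M.Q k) := by
      rw [← integral_const_mul, ← integral_const_mul,
        ← integral_add ((h1.integrable _).const_mul a) ((h2.integrable _).const_mul b)]
      rfl
    simp only [hg, Pi.add_apply, Pi.smul_apply, smul_eq_mul, Model.L1adj]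
    rw [hQs, hsum _ H.continuous_y, hsum _ (H.continuous_param _)]
    simp only [BoundedContinuousFunction.coe_add, BoundedContinuousFunction.coe_smul,
      Pi.add_apply, smul_eq_mul]
    have hr1 : M.r k = (a + b) * M.r k := by rw [hab, one_mul]
    conv_rhs => rw [hr1]
    ring
  have husc : ∀ f ∈ G, UpperSemicontinuous f := by
    rintro _ ⟨h, Λ, hf, rfl⟩
    have h1 : UpperSemicontinuous fun k : M.K =>
        - ∫ ξ, M.y ξ ∂Λ - (h (M.state k) - ∫ x, h x ∂(M.Q k)) :=
      (continuous_const.sub (hQc h)).upperSemicontinuous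
    have h2 : g h Λ = fun k => M.r k + M.L1adj Λ k +
        (- ∫ ξ, M.y ξ ∂Λ - (h (M.state k) - ∫ x, h x ∂(M.Q k))) := by
      funext k
      simp only [hg]
      ring
    rw [h2]
    exact (hr_usc.add (H.upperSemicontinuous_L1adj Λ)).add h1
  have hbdd : ∀ f ∈ G, ∃ c, ∀ k, f k ≤ c := by
    rintro _ ⟨h, Λ, hf, rfl⟩
    obtain ⟨C, hC⟩ := H.exists_abs_L1adj_le Λ
    refine ⟨C - ∫ ξ, M.y ξ ∂Λ + (‖h‖ + ‖h‖), fun k => ?_⟩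
    have h1 := (abs_le.1 (hC k)).2
    have h2 := (abs_le.1 (hQb h k)).1
    have h3 := H.r_nonpos k
    simp only [hg]
    linarith
  have hint : ∀ f ∈ G, ∀ μ : Measure M.K, IsProbabilityMeasure μ → Integrable M.r μ →
      Integrable f μ := by
    rintro _ ⟨h, Λ, hf, rfl⟩ μ hμp hμ
    exact (hμ.add (hLi Λ μ)).sub (hQi h μ)
  have hrG : M.r ∈ G := by
    refine ⟨0, 0, inferInstance, ?_⟩
    ext k; simp [hg, Model.L1adj]
  obtain ⟨f, ⟨h, Λ, hf, rfl⟩, hle⟩ := exists_forall_le_of_forall_exists_integral_lt H.r_nonpos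
    H.r_compact hcomb hrG husc hbdd hint (V := V) (by
      intro μ hμp hμ
      by_contra hcon
      push Not at hcon
      have hval : ∀ (h : S →ᵇ ℝ) (Λ : Measure M.Ξ), IsFiniteMeasure Λ → V ≤ ∫ k, M.r k ∂μ +
          ∫ k, (M.L1adj Λ k - ∫ ξ, M.y ξ ∂Λ) ∂μ -
          ∫ k, (h (M.state k) - ∫ x, h x ∂(M.Q k)) ∂μ := by
        intro h Λ hf
        have := hcon _ ⟨h, Λ, hf, rfl⟩
        have hadd : Integrable (fun k => M.r k + (M.L1adj Λ k - ∫ ξ, M.y ξ ∂Λ)) μ :=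
          hμ.add (hLi Λ μ)
        simp only [hg] at this
        rwa [integral_sub hadd (hQi h μ), integral_add hμ (hLi Λ μ)] at this
      -- An affine function bounded below on a half-line has nonnegative slope; scaling a multiplier
      -- thereby extracts each constraint: `h` and `-h` give invariance, `t • dirac ξ` gives
      -- dominance at `ξ`.
      have hlin : ∀ x y : ℝ, (∀ t : ℝ, 0 ≤ t → V ≤ x + t * y) → 0 ≤ y := by
        intro x y hxy
        by_contra hy
        push Not at hy
        have h1 := hxy ((|x - V| + 1) / (-y)) (div_nonneg (by positivity) (by linarith))
        have h2 : (|x - V| + 1) / (-y) * y = -(|x - V| + 1) := by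
          have : y ≠ 0 := hy.ne
          field_simp
        linarith [le_abs_self (x - V)]
      have hpos : ∀ h : S →ᵇ ℝ, 0 ≤ - ∫ k, (h (M.state k) - ∫ x, h x ∂(M.Q k)) ∂μ := by
        intro h
        refine hlin (∫ k, M.r k ∂μ) _ fun t _ => ?_
        have h1 := hval (t • h) 0 inferInstance
        have h2 : ∀ k, (t • h) (M.state k) - ∫ x, (t • h) x ∂(M.Q k) =
            t * (h (M.state k) - ∫ x, h x ∂(M.Q k)) := by
          intro k
          have : ∫ x, (t • h) x ∂(M.Q k) = t * ∫ x, h x ∂(M.Q k) := by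
            rw [← integral_const_mul]; rfl
          rw [this, mul_sub]; rfl
        simp only [h2, integral_const_mul, Model.L1adj, integral_zero_measure, sub_zero,
          integral_zero, add_zero] at h1
        linarith
      have hfeas : M.PrimalFeasible μ := by
        refine H.primalFeasible_of_tests hμ (fun h => ?_) fun ξ => ?_
        · have h1 := hpos h
          have h2 := hpos (-h)
          have h3 : ∀ k, (-h) (M.state k) - ∫ x, (-h) x ∂(M.Q k) =
              - (h (M.state k) - ∫ x, h x ∂(M.Q k)) := by
            intro k
            simp only [BoundedContinuousFunction.coe_neg, Pi.neg_apply, integral_neg]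
            ring
          simp only [h3] at h2
          rw [integral_neg] at h2
          linarith
        · suffices 0 ≤ M.L1 μ ξ - M.y ξ by linarith
          refine hlin (∫ k, M.r k ∂μ) _ fun t ht => ?_
          have : IsFiniteMeasure (ENNReal.ofReal t • Measure.dirac ξ) :=
            (Measure.dirac ξ).smul_finite ENNReal.ofReal_ne_top
          have h1 := hval 0 (ENNReal.ofReal t • Measure.dirac ξ) inferInstance
          simp only [Model.L1adj, integral_smul_measure, integral_dirac,
            ENNReal.toReal_ofReal ht, smul_eq_mul] at h1
          rw [integral_sub ((H.integrable_u_z ξ).const_mul t) (integrable_const _),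
            integral_const_mul] at h1
          simp only [integral_const, probReal_univ, smul_eq_mul, one_mul,
            BoundedContinuousFunction.coe_zero, Pi.zero_apply, sub_zero] at h1
          unfold Model.L1
          linarith
      have h1 := hval 0 0 inferInstance
      simp only [Model.L1adj, integral_zero_measure, sub_zero, integral_zero, add_zero,
        BoundedContinuousFunction.coe_zero, Pi.zero_apply] at h1
      exact absurd (hV μ hfeas) (not_lt.2 h1))
  -- This `β` absorbs the constant of the Lagrangian, so the dual objective is exactly `V`.
  refine ⟨h, V + ∫ ξ, M.y ξ ∂Λ, Λ, ⟨H.memF_boundedContinuous h, hf, fun k => ?_⟩, ?_⟩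
  · have := hle k
    simp only [hg] at this
    have hs : h k.1.1 = h (M.state k) := rfl
    linarith
  · unfold Model.dualObj
    linarith

end Model.Standing

end DominanceMDP

/-! ### Occupation measures of a policy and existence of a feasible measure. -/

namespace DominanceMDP

open MeasureTheory ProbabilityTheory Filter Topology
open scoped ENNReal BoundedContinuousFunction

lemma extExp_eq_integral {X : Type*} [MeasurableSpace X] {P : Measure X} {f : X → ℝ}
    (hf : Integrable f P) : extExp P f = ((∫ x, f x ∂P : ℝ) : EReal) := by
  have h1 : ∫⁻ x, ENNReal.ofReal (f x) ∂P ≠ ⊤ := hf.lintegral_lt_top.ne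
  have h2 : ∫⁻ x, ENNReal.ofReal (-f x) ∂P ≠ ⊤ := hf.neg.lintegral_lt_top.ne
  rw [integral_eq_lintegral_pos_part_sub_lintegral_neg_part hf, extExp, EReal.coe_sub,
    EReal.coe_ennreal_toReal h1, EReal.coe_ennreal_toReal h2]

section

variable {S A Ω : Type*}
    [TopologicalSpace S] [TopologicalSpace.MetrizableSpace S] [SecondCountableTopology S]
    [MeasurableSpace S] [BorelSpace S]
    [TopologicalSpace A] [TopologicalSpace.MetrizableSpace A] [SecondCountableTopology A]
    [MeasurableSpace A] [BorelSpace A]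

namespace Policy

variable {M : MDP S A} (π : Policy M)

lemma pair_state_preimage (t : ℕ) (h : (Fin t → M.K) × S) {B : Set S} (hB : MeasurableSet B) :
    π.pair t h (M.state ⁻¹' B) = B.indicator 1 h.2 := by
  classical
  have := π.markov_act
  have hmeas : MeasurableSet (((↑) : M.K → S × A) '' (M.state ⁻¹' B)) :=
    (MeasurableEmbedding.subtype_coe M.measurableSet_K).measurableSet_image.2
      (M.measurable_state hB)
  have hset : Prod.mk h.2 ⁻¹' (((↑) : M.K → S × A) '' (M.state ⁻¹' B)) =
      {a | (h.2, a) ∈ M.K ∧ h.2 ∈ B} := by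
    ext a
    constructor
    · rintro ⟨k, hk, hka⟩
      have h1 : M.state k = h.2 := congrArg Prod.fst hka
      exact ⟨hka ▸ k.2, h1 ▸ hk⟩
    · rintro ⟨h1, h2⟩
      exact ⟨⟨_, h1⟩, h2, rfl⟩
  unfold Policy.pair
  rw [Kernel.comapRight_apply' _ _ _ (M.measurable_state hB), Kernel.prod_apply,
    Kernel.deterministic_apply, Measure.dirac_prod,
    Measure.map_apply measurable_prodMk_left hmeas, hset]
  by_cases hs : h.2 ∈ B
  · simpa [hs] using π.feasible t h
  · simp [hs]

/-- The policy only selects the action, so the next state depends on the history through the last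
pair alone. -/
lemma step_state_preimage (t : ℕ) (k : Finset.Iic t → M.K) {B : Set S} (hB : MeasurableSet B) :
    π.step t k (M.state ⁻¹' B) = M.Q (k ⟨t, Finset.mem_Iic.2 le_rfl⟩) B := by
  have := M.markov_Q
  unfold Policy.step
  rw [Kernel.comp_apply' _ _ _ (M.measurable_state hB)]
  simp_rw [π.pair_state_preimage (t + 1) _ hB]
  have h1 : (fun h : (Fin (t + 1) → M.K) × S => B.indicator (1 : S → ℝ≥0∞) h.2) =
      (Prod.snd ⁻¹' B).indicator 1 := rfl
  rw [h1, lintegral_indicator_one (measurable_snd hB)]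
  unfold MDP.nextState
  rw [Kernel.prod_apply, Kernel.deterministic_apply, Measure.dirac_prod,
    Measure.map_apply measurable_prodMk_left (measurable_snd hB)]
  rfl

variable (ν : Measure S) [IsProbabilityMeasure ν]

instance : IsProbabilityMeasure (π.law ν) := by
  unfold Policy.law
  infer_instance

/-- The law of `(s_t, a_t)`. -/
noncomputable def marginal (t : ℕ) : Measure M.K := (π.law ν).map fun ω => ω t

instance (t : ℕ) : IsProbabilityMeasure (π.marginal ν t) :=
  Measure.isProbabilityMeasure_map (measurable_pi_apply t).aemeasurable

/-- The flow equation holds even for history-dependent policies: disintegrate the trajectory law at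
time `t` and apply `step_state_preimage`. -/
lemma marginal_succ_map_state (t : ℕ) :
    (π.marginal ν (t + 1)).map M.state = (π.marginal ν t).bind M.Q := by
  ext B hB
  have hB' := M.measurable_state hB
  have key := Kernel.map_frestrictLe_trajMeasure_compProd_eq_map_trajMeasure (X := fun _ => M.K)
    (μ₀ := π.initLaw ν) (κ := π.step) (a := t)
  have hm : Measurable (Preorder.frestrictLe (π := fun _ : ℕ => M.K) t) := by fun_prop
  have : IsProbabilityMeasure ((π.law ν).map (Preorder.frestrictLe (π := fun _ : ℕ => M.K) t)) :=
    Measure.isProbabilityMeasure_map hm.aemeasurable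
  have h1 := congrArg (fun m => m (Prod.snd ⁻¹' (M.state ⁻¹' B))) key
  rw [Measure.map_apply (by fun_prop) (measurable_snd hB')] at h1
  change ((π.law ν).map (Preorder.frestrictLe (π := fun _ : ℕ => M.K) t) ⊗ₘ π.step t) _ =
    (π.law ν) _ at h1
  rw [Measure.compProd_apply (measurable_snd hB')] at h1
  rw [Measure.map_apply M.measurable_state hB, marginal,
    Measure.map_apply (f := fun ω : ℕ → M.K => ω (t + 1)) (measurable_pi_apply _) hB',
    Measure.bind_apply hB M.Q.aemeasurable,
    marginal, lintegral_map (g := fun ω : ℕ → M.K => ω t) (M.Q.measurable_coe hB)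
      (measurable_pi_apply _)]
  refine h1.symm.trans ?_
  rw [lintegral_map (Kernel.measurable_kernel_prodMk_left (measurable_snd hB')) hm]
  refine lintegral_congr fun ω => ?_
  exact π.step_state_preimage t _ hB

lemma integral_marginal_succ (h : S →ᵇ ℝ) (t : ℕ) :
    ∫ k, h (M.state k) ∂(π.marginal ν (t + 1)) =
      ∫ k, ∫ x, h x ∂(M.Q k) ∂(π.marginal ν t) := by
  have := M.markov_Q
  rw [← integral_map (f := h) M.measurable_state.aemeasurable h.continuous.aestronglyMeasurable,
    π.marginal_succ_map_state ν t]
  have hh : Integrable h (M.Q ∘ₘ π.marginal ν t) := h.integrable _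
  change ∫ x, h x ∂(M.Q ∘ₘ π.marginal ν t) = _
  rw [Measure.comp_eq_comp_const_apply] at hh ⊢
  rw [Kernel.integral_comp hh, Kernel.const_apply]

/-- The occupation measure: the average of the laws of the first `T + 1` state-action pairs. -/
noncomputable def occupation (T : ℕ) : Measure M.K :=
  ENNReal.ofReal (1 / (T + 1 : ℕ)) • ∑ t ∈ Finset.range (T + 1), π.marginal ν t

instance (T : ℕ) : IsProbabilityMeasure (π.occupation ν T) := by
  refine ⟨?_⟩
  have : (0 : ℝ) < (T + 1 : ℕ) := by positivity
  simp only [occupation, Measure.coe_smul, Pi.smul_apply, Measure.coe_finsetSum,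
    Finset.sum_apply, measure_univ, Finset.sum_const, Finset.card_range, smul_eq_mul,
    nsmul_eq_mul, mul_one]
  rw [← ENNReal.ofReal_natCast, ← ENNReal.ofReal_mul (by positivity), one_div,
    inv_mul_cancel₀ this.ne', ENNReal.ofReal_one]

lemma lintegral_occupation (T : ℕ) (f : M.K → ℝ≥0∞) :
    ∫⁻ k, f k ∂(π.occupation ν T) =
      ENNReal.ofReal (1 / (T + 1 : ℕ)) *
        ∑ t ∈ Finset.range (T + 1), ∫⁻ k, f k ∂(π.marginal ν t) := by
  rw [occupation, lintegral_smul_measure, lintegral_finsetSum_measure, smul_eq_mul]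

lemma integral_occupation (T : ℕ) {f : M.K → ℝ} (hf : ∀ t, Integrable f (π.marginal ν t)) :
    ∫ k, f k ∂(π.occupation ν T) =
      1 / (T + 1 : ℕ) * ∑ t ∈ Finset.range (T + 1), ∫ k, f k ∂(π.marginal ν t) := by
  rw [occupation, integral_smul_measure, integral_finsetSum_measure fun t _ => hf t,
    ENNReal.toReal_ofReal (by positivity), smul_eq_mul]

/-- Integrability of the reward is not known beforehand, so the value is kept extended; only the
negative part contributes. -/
lemma extExp_law_of_nonpos {f : M.K → ℝ} (hf : Measurable f) (h0 : ∀ k, f k ≤ 0) (T : ℕ) :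
    extExp (π.law ν) (fun ω => ∑ t ∈ Finset.range T, f (ω t)) =
      - ((∑ t ∈ Finset.range T, ∫⁻ k, ENNReal.ofReal (- f k) ∂(π.marginal ν t) : ℝ≥0∞) :
        EReal) := by
  have h1 : ∀ ω : ℕ → M.K, ENNReal.ofReal (∑ t ∈ Finset.range T, f (ω t)) = 0 := fun ω =>
    ENNReal.ofReal_of_nonpos (Finset.sum_nonpos fun t _ => h0 _)
  have h2 : ∀ ω : ℕ → M.K, ENNReal.ofReal (- ∑ t ∈ Finset.range T, f (ω t)) =
      ∑ t ∈ Finset.range T, ENNReal.ofReal (- f (ω t)) := fun ω => by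
    rw [← Finset.sum_neg_distrib]
    exact ENNReal.ofReal_sum_of_nonneg fun t _ => by simpa using h0 (ω t)
  have hm : ∀ t : ℕ, Measurable fun ω : ℕ → M.K => ENNReal.ofReal (- f (ω t)) := fun t =>
    (hf.comp (measurable_pi_apply t)).neg.ennreal_ofReal
  unfold extExp
  simp_rw [h1, h2]
  rw [lintegral_finsetSum _ fun t _ => hm t]
  simp only [lintegral_zero, EReal.coe_ennreal_zero, zero_sub]
  congr 2
  refine Finset.sum_congr rfl fun t _ => ?_
  rw [marginal, lintegral_map (f := fun k => ENNReal.ofReal (- f k)) hf.neg.ennreal_ofReal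
    (measurable_pi_apply t)]

lemma extExp_law_of_bounded {f : M.K → ℝ} (hf : Measurable f) {C : ℝ} (hC : ∀ k, |f k| ≤ C)
    (T : ℕ) :
    extExp (π.law ν) (fun ω => ∑ t ∈ Finset.range T, f (ω t)) =
      ((∑ t ∈ Finset.range T, ∫ k, f k ∂(π.marginal ν t) : ℝ) : EReal) := by
  have hi : ∀ t : ℕ, Integrable (fun ω : ℕ → M.K => f (ω t)) (π.law ν) := fun t =>
    (integrable_const C).mono' (hf.comp (measurable_pi_apply t)).aestronglyMeasurable
      (Eventually.of_forall fun ω => hC _)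
  rw [extExp_eq_integral (integrable_finsetSum _ fun t _ => hi t),
    integral_finsetSum _ fun t _ => hi t]
  congr 1
  refine Finset.sum_congr rfl fun t _ => ?_
  rw [marginal, integral_map (measurable_pi_apply t).aemeasurable hf.aestronglyMeasurable]

end Policy

variable [MeasurableSpace Ω] {n p : ℕ} {M : Model S A Ω n p}

/-- The occupation measures of the consistent policy are asymptotically feasible: the lower limits
control reward and utilities, and the balance defect telescopes to order `1 / T`. -/
theorem Model.Standing.exists_primalFeasible (H : M.Standing) (hcons : M.Consistent) :
    ∃ μ, M.PrimalFeasible μ := by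
  have := M.markov_Q
  obtain ⟨π, ν, hR, hZ⟩ := hcons
  set P : ℕ → ProbabilityMeasure M.K := fun T => ⟨π.occupation (ν : Measure S) T, inferInstance⟩
   
  have hpos : ∀ T : ℕ, (0 : ℝ) < 1 / (T + 1 : ℕ) := fun T => by positivity
  obtain ⟨b, -, hb⟩ := EReal.lt_iff_exists_real_btwn.1 hR
  -- The shift matches the occupation measure with index `T`, which averages `T + 1` laws.
  have hbe := (tendsto_add_atTop_nat 1).eventually (eventually_lt_of_lt_liminf hb)
  have hrT : ∀ᶠ T in atTop, ∫⁻ k, ENNReal.ofReal (- M.r k) ∂(P T : Measure M.K) ≤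
      ENNReal.ofReal (-b) := by
    filter_upwards [hbe] with T hT
    rw [π.extExp_law_of_nonpos (ν : Measure S) M.measurable_r H.r_nonpos] at hT
    change ∫⁻ k, ENNReal.ofReal (- M.r k) ∂(π.occupation (ν : Measure S) T) ≤ _
    rw [π.lintegral_occupation]
    set X := ∑ t ∈ Finset.range (T + 1),
      ∫⁻ k, ENNReal.ofReal (- M.r k) ∂(π.marginal (ν : Measure S) t) with hX
    have hXt : X ≠ ⊤ := by
      -- An infinite expected cost would make the average `-∞`, contrary to its exceeding `b`.
      intro hXt
      rw [hXt, EReal.coe_ennreal_top, EReal.neg_top, EReal.coe_mul_bot_of_pos (hpos T)] at hT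
      exact not_lt_bot hT
    rw [← EReal.coe_ennreal_toReal hXt, ← EReal.coe_neg, ← EReal.coe_mul,
      EReal.coe_lt_coe_iff] at hT
    rw [← ENNReal.ofReal_toReal hXt, ← ENNReal.ofReal_mul (hpos T).le]
    exact ENNReal.ofReal_le_ofReal (by linarith)
  refine (H.exists_primalFeasible_of_asymptotic (μs := P) (c := max (-b) 0)
    (le_max_right _ _) (fun c' hc' => hrT.mono fun T hT => hT.trans
      (ENNReal.ofReal_le_ofReal ((le_max_left _ _).trans hc'.le))) (fun h => ?_)
      fun ξ ε hε => ?_).imp fun μ hμ => hμ.1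
  · have hQn : ∀ k, ‖∫ x, h x ∂(M.Q k)‖ ≤ ‖h‖ := fun k => by
      simpa using norm_integral_le_of_norm_le_const (μ := M.Q k)
        (Eventually.of_forall h.norm_coe_le_norm)
    have hi1 : ∀ t, Integrable (fun k => h (M.state k)) (π.marginal (ν : Measure S) t) := fun t =>
      (integrable_const ‖h‖).mono'
        (h.continuous.comp M.continuous_state).aestronglyMeasurable
        (Eventually.of_forall fun k => h.norm_coe_le_norm _)
    have hi2 : ∀ t, Integrable (fun k => ∫ x, h x ∂(M.Q k)) (π.marginal (ν : Measure S) t) :=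
      fun t => (integrable_const ‖h‖).mono' (H.weaklyContinuous h).aestronglyMeasurable
        (Eventually.of_forall hQn)
    have hb1 : ∀ t, |∫ k, h (M.state k) ∂(π.marginal (ν : Measure S) t)| ≤ ‖h‖ := fun t => by
      simpa using norm_integral_le_of_norm_le_const (μ := π.marginal (ν : Measure S) t)
        (f := fun k => h (M.state k)) (Eventually.of_forall fun k => h.norm_coe_le_norm _)
    have hval : ∀ T, ∫ k, (h (M.state k) - ∫ x, h x ∂(M.Q k)) ∂(P T : Measure M.K) =
        1 / (T + 1 : ℕ) * (∫ k, h (M.state k) ∂(π.marginal (ν : Measure S) 0) -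
          ∫ k, h (M.state k) ∂(π.marginal (ν : Measure S) (T + 1))) := by
      intro T
      change ∫ k, (h (M.state k) - ∫ x, h x ∂(M.Q k)) ∂(π.occupation (ν : Measure S) T) = _
      rw [π.integral_occupation (f := fun k => h (M.state k) - ∫ x, h x ∂(M.Q k)) _ T
        fun t => (hi1 t).sub (hi2 t),
        ← Finset.sum_range_sub' (fun t => ∫ k, h (M.state k) ∂(π.marginal (ν : Measure S) t))]
      congr 1
      refine Finset.sum_congr rfl fun t _ => ?_
      rw [integral_sub (hi1 t) (hi2 t), π.integral_marginal_succ]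
    refine squeeze_zero_norm (a := fun T : ℕ => 1 / (T + 1 : ℕ) * (‖h‖ + ‖h‖)) (fun T => ?_) ?_
    · rw [hval, norm_mul, Real.norm_of_nonneg (hpos T).le]
      exact mul_le_mul_of_nonneg_left ((norm_sub_le _ _).trans (add_le_add (hb1 0) (hb1 _)))
        (hpos T).le
    · have := (tendsto_one_div_add_atTop_nhds_zero_nat (𝕜 := ℝ)).mul_const (‖h‖ + ‖h‖)
      simpa using this
  · obtain ⟨C, -, hC⟩ := H.exists_abs_u_z_le
    have hlt : ((M.y ξ - ε : ℝ) : EReal) < π.avg (ν : Measure S) (fun k => M.u (M.z k) ξ) :=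
      lt_of_lt_of_le (EReal.coe_lt_coe_iff.2 (by linarith)) (hZ ξ)
    filter_upwards [(tendsto_add_atTop_nat 1).eventually (eventually_lt_of_lt_liminf hlt)]
      with T hT
    rw [π.extExp_law_of_bounded (ν : Measure S) (H.upperSemicontinuous_u_z ξ).measurable
      (fun k => hC k ξ), ← EReal.coe_mul, EReal.coe_lt_coe_iff] at hT
    refine hT.le.trans (le_of_eq ?_)
    change _ = ∫ k, M.u (M.z k) ξ ∂(π.occupation (ν : Measure S) T)
    rw [π.integral_occupation _ T fun t => H.integrable_u_z ξ]

end

end DominanceMDP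

/-! ### Attainment in both programs and equality of the values. -/

namespace DominanceMDP

open MeasureTheory ProbabilityTheory Filter Topology
open scoped ENNReal BoundedContinuousFunction

/-- Finite measures of bounded mass on a compact metrizable space have a weakly convergent
subsequence. -/
lemma exists_subseq_tendsto_integral {X : Type*} [TopologicalSpace X]
    [TopologicalSpace.MetrizableSpace X] [SecondCountableTopology X] [CompactSpace X]
    [MeasurableSpace X] [BorelSpace X] (Λ : ℕ → Measure X) [∀ i, IsFiniteMeasure (Λ i)] {C : ℝ}
    (hC : ∀ i, (Λ i).real Set.univ ≤ C) :
    ∃ (Λ' : Measure X) (φ : ℕ → ℕ), IsFiniteMeasure Λ' ∧ StrictMono φ ∧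
      ∀ f : X → ℝ, Continuous f →
        Tendsto (fun i => ∫ x, f x ∂(Λ (φ i))) atTop (𝓝 (∫ x, f x ∂Λ')) := by
  rcases isEmpty_or_nonempty X with hX | hX
  · refine ⟨0, id, inferInstance, strictMono_id, fun f _ => ?_⟩
    simp [Measure.eq_zero_of_isEmpty]
  let F : ℕ → FiniteMeasure X := fun i => ⟨Λ i, inferInstance⟩
  -- Splitting into mass and normalized part places the sequence in the compact space `[0, C] ×
  -- P(X)`; normalizing needs `X` nonempty.
  have hF : ∀ i, (Λ i) = ENNReal.ofReal ((Λ i).real Set.univ) • ((F i).normalize : Measure X) := by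
    intro i
    ext s hs
    rw [ofReal_measureReal]
    have h1 := congrArg (fun m : FiniteMeasure X => (m : Measure X) s)
      (F i).self_eq_mass_smul_normalize
    have h2 : ((F i).mass : ℝ≥0∞) = Λ i Set.univ := (F i).ennreal_mass
    rw [← h2]
    exact h1
  have hcomp : IsCompact (Set.Icc (0 : ℝ) C ×ˢ (Set.univ : Set (ProbabilityMeasure X))) :=
    isCompact_Icc.prod isCompact_univ
  obtain ⟨⟨m, P⟩, hmem, φ, hφ, hlim⟩ := hcomp.tendsto_subseq
    (x := fun i => ((Λ i).real Set.univ, (F i).normalize))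
    fun i => ⟨⟨measureReal_nonneg, hC i⟩, trivial⟩
  have hm0 : 0 ≤ m := hmem.1.1
  refine ⟨ENNReal.ofReal m • (P : Measure X), φ,
    Measure.smul_finite (P : Measure X) ENNReal.ofReal_ne_top, hφ, fun f hf => ?_⟩
  have h1 : Tendsto (fun i => (Λ (φ i)).real Set.univ) atTop (𝓝 m) :=
    (continuous_fst.tendsto _).comp hlim
  have h2 : Tendsto (fun i => (F (φ i)).normalize) atTop (𝓝 P) :=
    (continuous_snd.tendsto _).comp hlim
  have h3 := ProbabilityMeasure.tendsto_iff_forall_integral_tendsto.1 h2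
    (BoundedContinuousFunction.mkOfCompact ⟨f, hf⟩)
  rw [integral_smul_measure, ENNReal.toReal_ofReal hm0]
  refine (h1.smul h3).congr fun i => ?_
  conv_rhs => rw [hF (φ i)]
  rw [integral_smul_measure, ENNReal.toReal_ofReal measureReal_nonneg]
  rfl

variable {S A Ω : Type*}
    [TopologicalSpace S] [TopologicalSpace.MetrizableSpace S] [SecondCountableTopology S]
    [MeasurableSpace S] [BorelSpace S]
    [TopologicalSpace A] [TopologicalSpace.MetrizableSpace A] [SecondCountableTopology A]
    [MeasurableSpace A] [BorelSpace A]
    [MeasurableSpace Ω] {n p : ℕ}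

namespace Model.Standing

variable {M : Model S A Ω n p} (H : M.Standing)
include H

/-- The lower limit of asymptotically feasible relative value functions that are bounded in
`F_ŵ(S)` is feasible for the limiting data. -/
lemma exists_memF_of_tendsto {h : ℕ → S → ℝ} (hm : ∀ i, Measurable (h i)) {C : ℝ}
    (hC : ∀ i s, |h i s| ≤ C * M.wHat s) {c : ℕ → M.K → ℝ} {c' : M.K → ℝ}
    (hc : ∀ k, Tendsto (fun i => c i k) atTop (𝓝 (c' k)))
    (hle : ∀ i k, c i k ≤ h i (M.state k) - ∫ x, h i x ∂(M.Q k)) :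
    ∃ h', MemF M.wHat h' ∧ ∀ k, c' k ≤ h' (M.state k) - ∫ x, h' x ∂(M.Q k) := by
  -- Tail infima: they increase to the lower limit of `h` and stay dominated by `C * ŵ`, which is
  -- integrable under each `Q(· | k)`.
  set g : ℕ → S → ℝ := fun N s => ⨅ i, h (N + i) s with hg
  have hbb : ∀ N s, BddBelow (Set.range fun i => h (N + i) s) := fun N s =>
    ⟨-(C * M.wHat s), by rintro _ ⟨i, rfl⟩; exact (abs_le.1 (hC _ s)).1⟩
  have hgm : ∀ N, Measurable (g N) := fun N => Measurable.iInf fun i => hm _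
  have hgC : ∀ N s, |g N s| ≤ C * M.wHat s := fun N s => abs_le.2
    ⟨le_ciInf fun i => (abs_le.1 (hC _ s)).1,
      (ciInf_le (hbb N s) 0).trans (abs_le.1 (hC _ s)).2⟩
  have hgmono : ∀ s, Monotone fun N => g N s := fun s N N' hN =>
    le_ciInf fun i => (ciInf_le (hbb N s) (N' - N + i)).trans
      (le_of_eq (congrArg (fun j => h j s)
        (by have : N ≤ N' := hN
            omega)))
  have hgb : ∀ s, BddAbove (Set.range fun N => g N s) := fun s =>
    ⟨C * M.wHat s, by rintro _ ⟨N, rfl⟩; exact (abs_le.1 (hgC N s)).2⟩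
  set h' : S → ℝ := fun s => ⨆ N, g N s with hh'
  have hlim : ∀ s, Tendsto (fun N => g N s) atTop (𝓝 (h' s)) := fun s =>
    tendsto_atTop_ciSup (hgmono s) (hgb s)
  have hh'C : ∀ s, |h' s| ≤ C * M.wHat s := fun s =>
    le_of_tendsto (hlim s).abs (Eventually.of_forall fun N => hgC N s)
  refine ⟨h', ⟨Measurable.iSup hgm, C, fun s =>
    (div_le_iff₀ (zero_lt_one.trans_le (H.one_le_wHat s))).2 (hh'C s)⟩, fun k => ?_⟩
  have hwi : Integrable (fun s => C * M.wHat s) (M.Q k) := (H.weightBounded.1 k).const_mul C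
  have hhi : ∀ i, Integrable (h i) (M.Q k) := fun i =>
    hwi.mono' (hm i).aestronglyMeasurable (Eventually.of_forall (hC i))
  have hgi : ∀ N, Integrable (g N) (M.Q k) := fun N =>
    hwi.mono' (hgm N).aestronglyMeasurable (Eventually.of_forall (hgC N))
  have hint : Tendsto (fun N => ∫ x, g N x ∂(M.Q k)) atTop (𝓝 (∫ x, h' x ∂(M.Q k))) :=
    tendsto_integral_of_dominated_convergence _ (fun N => (hgm N).aestronglyMeasurable) hwi
      (fun N => Eventually.of_forall (hgC N)) (Eventually.of_forall hlim)
  refine le_of_forall_pos_sub_le fun ε hε => ?_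
  refine ge_of_tendsto ((hlim (M.state k)).sub hint) ?_
  obtain ⟨N0, hN0⟩ := eventually_atTop.1 ((hc k).eventually_const_lt (sub_lt_self (c' k) hε))
  filter_upwards [eventually_ge_atTop N0] with N hN
  -- Since `g N` lies below every later `h`, the left side is a lower bound for each `h (N + i)` at
  -- the state, hence for their infimum.
  have : c' k - ε + ∫ x, g N x ∂(M.Q k) ≤ g N (M.state k) := by
    refine le_ciInf fun i => ?_
    have h1 := hle (N + i) k
    have h2 := hN0 (N + i) (by omega)
    have h3 : ∫ x, g N x ∂(M.Q k) ≤ ∫ x, h (N + i) x ∂(M.Q k) :=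
      integral_mono (hgi N) (hhi _) fun x => ciInf_le (hbb N x) i
    linarith
  linarith

/-- Subsequences give limits of `Λ` and `β`, and `h` is replaced by its lower limit. The constraint
passes to the limit because `u(z; ·)` is continuous on `Ξ`, the objective because `y` is. -/
theorem dualSolvable_of_boundedMinimizingSequence (hb : M.BoundedMinimizingSequence) :
    M.DualSolvable := by
  have := H.compactSpace
  obtain ⟨h, β, Λ, hfeas, hlim, ⟨Cβ, hβ⟩, ⟨Ch, hh⟩, hΛ⟩ := hb
  have hfin : ∀ i, IsFiniteMeasure (Λ i) := fun i => (hfeas i).finite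
  -- For nonnegative measures, testing on the constant `1` already bounds the total mass.
  obtain ⟨CΛ, hCΛ⟩ := hΛ (ContinuousMap.const _ 1)
  obtain ⟨Λ', φ, hΛ'f, hφ, hΛ'⟩ := exists_subseq_tendsto_integral Λ (C := CΛ) (fun i => by
    have := (le_abs_self _).trans (hCΛ i)
    simpa using this)
  obtain ⟨β', -, ψ, hψ, hβ'⟩ := (isCompact_Icc (a := -Cβ) (b := Cβ)).tendsto_subseq
    (x := fun i => β (φ i)) fun i => ⟨(abs_le.1 (hβ _)).1, (abs_le.1 (hβ _)).2⟩
  have hΛψ : ∀ f : M.Ξ → ℝ, Continuous f →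
      Tendsto (fun i => ∫ ξ, f ξ ∂(Λ (φ (ψ i)))) atTop (𝓝 (∫ ξ, f ξ ∂Λ')) := fun f hf =>
    (hΛ' f hf).comp hψ.tendsto_atTop
  obtain ⟨h', hh'm, hh'⟩ := H.exists_memF_of_tendsto (h := fun i => h (φ (ψ i))) (C := Ch)
    (fun i => (hfeas _).mem.1)
    (fun i s => (div_le_iff₀ (zero_lt_one.trans_le (H.one_le_wHat s))).1 (hh _ s))
    (c := fun i k => M.r k + M.L1adj (Λ (φ (ψ i))) k - β (φ (ψ i)))
    (c' := fun k => M.r k + M.L1adj Λ' k - β')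
    (fun k => ((hΛψ _ (H.continuous_param (M.z k))).const_add _).sub hβ')
    (fun i k => by
      have := (hfeas (φ (ψ i))).constraint k
      have hs : h (φ (ψ i)) k.1.1 = h (φ (ψ i)) (M.state k) := rfl
      linarith)
  refine ⟨h', β', Λ', ⟨hh'm, hΛ'f, fun k => ?_⟩, ?_⟩
  · have := hh' k
    have hs : h' k.1.1 = h' (M.state k) := rfl
    linarith
  · have h1 : Tendsto (fun i => M.dualObj (β (φ (ψ i))) (Λ (φ (ψ i)))) atTop
        (𝓝 (M.dualObj β' Λ')) := hβ'.sub (hΛψ _ H.continuous_y)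
    exact tendsto_nhds_unique ((continuous_coe_real_ereal.tendsto _).comp h1)
      (hlim.comp (hφ.comp hψ).tendsto_atTop)

/-- A maximizing sequence is exactly feasible and has `∫ -r` eventually below any number above
`-sup`, so its weak limit points are optimal. -/
theorem primalSolvable (hne : ∃ μ, M.PrimalFeasible μ) :
    ∃ μ, M.PrimalFeasible μ ∧ ∀ μ', M.PrimalFeasible μ' → M.primalObj μ' ≤ M.primalObj μ := by
  obtain ⟨μ0, hμ0⟩ := hne
  have hnp : ∀ μ, M.primalObj μ ≤ 0 := fun μ => integral_nonpos H.r_nonpos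
  set V : Set ℝ := {v | ∃ μ, M.PrimalFeasible μ ∧ v = M.primalObj μ} with hV
  have hVne : V.Nonempty := ⟨_, μ0, hμ0, rfl⟩
  have hVb : BddAbove V := ⟨0, by rintro _ ⟨μ, -, rfl⟩; exact hnp μ⟩
  obtain ⟨v, -, hv, hvV⟩ := exists_seq_tendsto_sSup hVne hVb
  choose μs hμs hvs using hvV
  have hprob : ∀ i, IsProbabilityMeasure (μs i) := fun i => isProbabilityMeasure_of_feasible (hμs i)
  have hri : ∀ i, Integrable M.r (μs i) := fun i => H.memM_iff.1 (hμs i).mem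
  obtain ⟨μ, hμ, hle⟩ := H.exists_primalFeasible_of_asymptotic
    (μs := fun i => ⟨μs i, hprob i⟩) (c := - sSup V)
    (by
      have := csSup_le hVne (a := 0) (by rintro _ ⟨μ, -, rfl⟩; exact hnp μ)
      linarith)
    (fun c' hc' => by
      filter_upwards [hv.eventually_const_lt (show -c' < sSup V by linarith)] with i hi
      change ∫⁻ k, ENNReal.ofReal (- M.r k) ∂(μs i) ≤ _
      rw [← ofReal_integral_eq_lintegral_ofReal (f := fun k => - M.r k) (hri i).neg
        (Eventually.of_forall fun k => by simpa using H.r_nonpos k), integral_neg]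
      refine ENNReal.ofReal_le_ofReal ?_
      have := hvs i
      unfold Model.primalObj at this
      linarith)
    (fun h => by
      refine tendsto_const_nhds.congr fun i => ?_
      change _ = ∫ k, (h (M.state k) - ∫ x, h x ∂(M.Q k)) ∂(μs i)
      have hF := H.memF_boundedContinuous h
      rw [integral_sub (H.integrable_state hF (hri i)) (H.integrable_integral_Q hF (hri i)),
        H.integral_state_eq (hμs i) hF, sub_self])
    (fun ξ ε hε => Eventually.of_forall fun i => by
      have := (hμs i).dominance ξ
      change _ ≤ M.L1 (μs i) ξ
      linarith)
  refine ⟨μ, hμ, fun μ' hμ' => ?_⟩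
  have := le_csSup hVb ⟨μ', hμ', rfl⟩
  linarith

omit H in
lemma nonempty_K {μ : Measure M.K} (hμ : M.PrimalFeasible μ) : Nonempty M.K := by
  have := isProbabilityMeasure_of_feasible hμ
  exact nonempty_of_isProbabilityMeasure μ

theorem duality (hcons : M.Consistent) :
    M.primalValue = M.dualValue ∧ M.PrimalSolvable := by
  obtain ⟨μ, hμ, hmax⟩ := H.primalSolvable (H.exists_primalFeasible hcons)
  have := nonempty_K hμ
  have hval : (M.primalObj μ : EReal) = M.primalValue := by
    refine le_antisymm (le_sSup ⟨μ, hμ, rfl⟩) (sSup_le ?_)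
    rintro _ ⟨μ', hμ', rfl⟩
    exact EReal.coe_le_coe_iff.2 (hmax μ' hμ')
  refine ⟨le_antisymm ?_ ?_, μ, hμ, hval⟩
  · rw [← hval]
    refine le_sInf ?_
    rintro _ ⟨h, β, Λ, hd, rfl⟩
    exact EReal.coe_le_coe_iff.2 (H.weak_duality hμ hd)
  · rw [← hval]
    -- Every real `V` above the attained primal value is an upper bound for the dual value.
    refine EReal.le_of_forall_lt_iff_le.1 fun V hV => ?_
    obtain ⟨h, β, Λ, hd, hle⟩ := H.exists_dualFeasible_le (V := V) fun μ' hμ' =>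
      (hmax μ' hμ').trans_lt (EReal.coe_lt_coe_iff.1 hV)
    have hinf : M.dualValue ≤ (M.dualObj β Λ : EReal) := sInf_le ⟨h, β, Λ, hd, rfl⟩
    exact hinf.trans (EReal.coe_le_coe_iff.2 hle)

end Model.Standing

end DominanceMDP

theorem mainTheorem9 {S A Ω : Type*}
    [TopologicalSpace S] [TopologicalSpace.MetrizableSpace S] [SecondCountableTopology S]
    [MeasurableSpace S] [BorelSpace S] [StandardBorelSpace S]
    [TopologicalSpace A] [TopologicalSpace.MetrizableSpace A] [SecondCountableTopology A]
    [MeasurableSpace A] [BorelSpace A] [StandardBorelSpace A]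
    [MeasurableSpace Ω] {n p : ℕ} (M : DominanceMDP.Model S A Ω n p)
    -- consistency of the decision problem
    (hcons : M.Consistent)
    -- the reward is nonpositive with compact superlevel sets
    (hr : ∀ k, M.r k ≤ 0)
    (hrc : ∀ ε : ℝ, 0 ≤ ε → IsCompact {k : M.K | -ε ≤ M.r k})
    -- `z` is bounded and (componentwise) upper semicontinuous
    (hzb : ∃ C : ℝ, ∀ k, ‖M.z k‖ ≤ C)
    (hzu : ∀ i, UpperSemicontinuous fun k => M.z k i)
    -- the transition law
    (hQ : M.WeaklyContinuous)
    (hQw : M.WeightBounded)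
    -- the generating family: increasing, concave, continuous in the parameter, `Ξ` compact
    (hΞ : IsCompact M.Ξ)
    (hmono : ∀ ξ : M.Ξ, Monotone fun x => M.u x ξ)
    (hconc : ∀ ξ : M.Ξ, ConcaveOn ℝ Set.univ fun x => M.u x ξ)
    (hcont : ∀ x, Continuous fun ξ : M.Ξ => M.u x ξ)
    -- the benchmark is a random vector with bounded support
    [MeasureTheory.IsProbabilityMeasure M.P]
    (hY : Measurable M.Y)
    (hYb : ∃ a b : Fin n → ℝ, ∀ᵐ ω ∂M.P, M.Y ω ∈ Set.Icc a b) :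
    M.primalValue = M.dualValue ∧ M.PrimalSolvable ∧
      (M.BoundedMinimizingSequence → M.DualSolvable ∧ M.StrongDuality) := by
  have H : M.Standing := ⟨hr, hrc, hzb, hzu, hQ, hQw, hΞ, hmono, hconc, hcont, inferInstance, hY,
    hYb⟩
  obtain ⟨hval, hsol⟩ := H.duality hcons
  refine ⟨hval, hsol, fun hb => ?_⟩
  have hd := H.dualSolvable_of_boundedMinimizingSequence hb
  exact ⟨hd, hval, hsol, hd⟩
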